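/- Let $k$ be a field of characteristic zero and let $B=\bigoplus_{i\ge 0}B_i$ be a standard graded artinian $k$-algebra, that is, an artinian quotient of a polynomial ring over $k$ in finitely many variables of degree one by a homogeneous ideal. Put $h_i=\dim_k B_i$ for $i\ge 0$ and $h_i=0$ for $i<0$. A graded $k$-algebra $A$ has the strong Lefschetz property (SLP) if there is a linear form $\ell\in A_1$ such that for all $i,t\ge 0$ the multiplication map $\cdot\ell^t:A_i\to A_{i+t}$ has full rank, i.e. is injective or surjective. The algebra $B$ is almost centered if for all integers $i<j$ the following two conditions hold: if $h_i<h_j$, then $h_{i-s}\le h_{j+s}$ for every $s\ge 0$; and if $h_i>h_j$, then $h_{i-s}\ge h_{j+s}$ for every $s\ge 0$. Let $n\ge 1$. For all $d_1,\dots,d_n\ge 1$ there is an isomorphism of graded $k$-algebras $$B\otimes_k k[x_1]/(x_1^{d_1})\otimes_k\cdots\otimes_k k[x_n]/(x_n^{d_n})\;\cong\; B\otimes_k k[x_1,\dots,x_n]/(x_1^{d_1},\dots,x_n^{d_n}),$$ where all variables have degree one and tensor products carry the total grading. Moreover, this algebra has the SLP for all $d_1,\dots,d_n\ge 1$ if and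 only if $B$ is almost centered and has the SLP. -/

import Mathlib

open scoped TensorProduct

namespace Lefschetz

/-- A commutative graded `k`-algebra `A = ⨁ 𝒜 i` (indexed by `ℕ`) is standard graded if `A₀ = k`
and `A` is generated, as a `k`-algebra, by the finite dimensional space `A₁`; equivalently, `A` is
a quotient of a polynomial ring `k[x₁, …, x_n]` by a homogeneous ideal. -/
structure IsStandardGraded {k A : Type*} [Field k] [CommRing A] [Algebra k A]
    (𝒜 : ℕ → Submodule k A) [GradedAlgebra 𝒜] : Prop where
  degree_zero : 𝒜 0 = 1
  adjoin_degree_one : Algebra.adjoin k (𝒜 1 : Set A) = ⊤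
  finite_degree_one : FiniteDimensional k (𝒜 1)

/-- The strong Lefschetz property: there is a linear form `ℓ ∈ A₁` such that, for all `t` and `i`,
multiplication by `ℓ ^ t` from `A_i` to `A_{i+t}` has full rank, i.e. is injective or
surjective. -/
def HasSLP {k A : Type*} [Field k] [CommRing A] [Algebra k A] (𝒜 : ℕ → Submodule k A) : Prop :=
  ∃ ℓ ∈ 𝒜 1, ∀ t i : ℕ,
    Set.InjOn (fun a : A => ℓ ^ t * a) (𝒜 i) ∨
      Set.SurjOn (fun a : A => ℓ ^ t * a) (𝒜 i) (𝒜 (i + t))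

/-- The Hilbert function `h_i = dim_k A_i`, extended by `0` to negative `i`. -/
noncomputable def hilb {k A : Type*} [Field k] [CommRing A] [Algebra k A]
    (𝒜 : ℕ → Submodule k A) (i : ℤ) : ℕ :=
  if 0 ≤ i then Module.finrank k (𝒜 i.toNat) else 0

/-- Almost centered graded algebras. -/
def IsAlmostCentered {k A : Type*} [Field k] [CommRing A] [Algebra k A]
    (𝒜 : ℕ → Submodule k A) : Prop :=
  (∀ i j : ℤ, i < j → hilb 𝒜 i < hilb 𝒜 j → ∀ s : ℕ, hilb 𝒜 (i - s) ≤ hilb 𝒜 (j + s)) ∧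
  (∀ i j : ℤ, i < j → hilb 𝒜 j < hilb 𝒜 i → ∀ s : ℕ, hilb 𝒜 (j + s) ≤ hilb 𝒜 (i - s))

/-- The usual grading on `A ⊗ C`: the degree `m` part is the sum over `i + j = m` of the spans of
the `a ⊗ c` with `a ∈ A_i` and `c ∈ C_j`. -/
noncomputable def tensorGrading {k A C : Type*} [Field k] [CommRing A] [Algebra k A] [CommRing C] [Algebra k C]
    (𝒜 : ℕ → Submodule k A) (𝒞 : ℕ → Submodule k C) (m : ℕ) : Submodule k (A ⊗[k] C) :=
  ⨆ (i : ℕ) (j : ℕ) (_ : i + j = m), Submodule.map₂ (TensorProduct.mk k A C) (𝒜 i) (𝒞 j)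

/-- The usual grading on a tensor product `⨂ A_i` of a family of graded algebras: the degree `m`
part is spanned by the pure tensors of homogeneous elements whose degrees add up to `m`. -/
noncomputable def piTensorGrading {k ι : Type*} [Field k] [Fintype ι] {A : ι → Type*} [∀ i, CommRing (A i)]
    [∀ i, Algebra k (A i)] (𝒜 : ∀ i, ℕ → Submodule k (A i)) (m : ℕ) :
    Submodule k (⨂[k] i, A i) :=
  Submodule.span k {z | ∃ (e : ι → ℕ) (x : ∀ i, A i),
    ∑ i, e i = m ∧ (∀ i, x i ∈ 𝒜 i (e i)) ∧ PiTensorProduct.tprod k x = z}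

/-- The algebra `k[x]/(x^d)`; the class of `x` is `AdjoinRoot.root (x ^ d)`. -/
noncomputable abbrev Trunc (k : Type*) [Field k] (d : ℕ) : Type _ :=
  AdjoinRoot ((Polynomial.X : Polynomial k) ^ d)

/-- The grading on `k[x]/(x^d)` by degree: the degree `m` part is spanned by the class of `x^m`. -/
noncomputable def truncGrading (k : Type*) [Field k] (d m : ℕ) : Submodule k (Trunc k d) :=
  Submodule.span k {AdjoinRoot.root ((Polynomial.X : Polynomial k) ^ d) ^ m}

/-- The monomial complete intersection `k[x₁, …, x_n]/(x₁^{d₁}, …, x_n^{d_n})`. -/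
noncomputable abbrev MonomialCI (k : Type*) [Field k] {n : ℕ} (d : Fin n → ℕ) : Type _ :=
  MvPolynomial (Fin n) k ⧸
    Ideal.span (Set.range fun i : Fin n => (MvPolynomial.X i : MvPolynomial (Fin n) k) ^ d i)

/-- The grading on `k[x₁, …, x_n]/(x₁^{d₁}, …, x_n^{d_n})` by degree: the degree `m` part consists
of the classes of the homogeneous polynomials of degree `m`. -/
noncomputable def monomialCIGrading (k : Type*) [Field k] {n : ℕ} (d : Fin n → ℕ) (m : ℕ) :
    Submodule k (MonomialCI k d) :=
  (MvPolynomial.homogeneousSubmodule (Fin n) k m).map (Ideal.Quotient.mkₐ k _).toLinearMap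

end Lefschetz

/-! The isomorphism comes from `k[x₁]/(x₁^{d₁}) ⊗ ⋯ ⊗ k[x_n]/(x_n^{d_n}) ≅ k[x₁,…,x_n]/(x_i^{d_i})`,
tensored with `B`. The rest concerns the Lefschetz property.

Sufficiency is an `sl₂` argument. If `E` raises degrees, `F` lowers them and `EF - FE = 2i - c` in
degree `i`, then `E^t` on degree `i` is injective for `2i + t ≤ c` and surjective for `2i + t ≥ c`
(`pow_raise_injective`, `pow_raise_surjective`). On the monomial complete intersection, `E = ∑ x_i`
has such an `F` with `c = ∑ (d_i - 1)` (`exists_ciLower`). On `B`, the SLP makes the Hilbert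
function unimodal, and being almost centered then yields one number `C` (`exists_center`) such that
every Jordan string of `ℓ`, from degree `a` to `a + r`, has `2a + r` equal to `C` or `C + 1`. The
lowering operators of the strings add up to one with commutator `2i - C - π`, where `π` projects
onto the strings of the second kind (`IsNearlyLefschetz.exists_isLowering`). Lowering operators add
on tensor products, so the product splits into two pieces with adjacent centers. An integer `2m + t`
is at most the smaller center or at least the larger one, so both pieces are injective or both are
surjective.

Necessity uses only exponents `(d, 1, …, 1)`, that is, one extra variable `x`; `d = 1` returns `B`
itself. If `(i, j, s)` violates the almost centered condition, take `d = j - i + s`. For any linear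
form `ℓ + cx`, its power `s + 1` from degree `j - 1` to `j + s` has a kernel and misses part of the
target: a drop of the Hilbert function gives a short string of `ℓ`, hence a kernel by counting
dimensions (`IsCoeff.exists_pow_mul_eq_zero`), and a rise gives a functional killed by an early
power of `ℓ`, hence a cokernel by the dual count (`IsCoeff.exists_forall_pow_mul_ne`). -/

namespace Lefschetz

/-! ### Raising and lowering operators with one center -/

section RaisingLowering

variable {k V : Type*} [Field k] [AddCommGroup V] [Module k V]
  {W : ℕ → Submodule k V} {E F : Module.End k V} {c : ℕ}

theorem pow_raise_mem (hE : ∀ i, ∀ x ∈ W i, E x ∈ W (i + 1)) (t : ℕ) {i : ℕ} {x : V}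
    (hx : x ∈ W i) : (E ^ t) x ∈ W (i + t) := by
  induction t with
  | zero => simpa using hx
  | succ t ih => rw [pow_succ', Module.End.mul_apply]; exact hE _ _ ih

theorem pow_lower_mem (hF : ∀ i, ∀ x ∈ W (i + 1), F x ∈ W i) (t : ℕ) {i : ℕ} {x : V}
    (hx : x ∈ W (i + t)) : (F ^ t) x ∈ W i := by
  induction t generalizing x with
  | zero => simpa using hx
  | succ t ih => rw [pow_succ, Module.End.mul_apply]; exact ih (hF _ _ hx)

/-- Moving `F` to the left past `t + 1` factors `E` picks up the weights `2l - c` for `l = i, …, i +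
t`; the scalar is their sum. -/
theorem pow_raise_lower (hE : ∀ i, ∀ x ∈ W i, E x ∈ W (i + 1))
    (hEF : ∀ i, ∀ x ∈ W i, E (F x) - F (E x) = (2 * (i : k) - c) • x)
    (t : ℕ) {i : ℕ} {x : V} (hx : x ∈ W i) :
    (E ^ (t + 1)) (F x) =
      F ((E ^ (t + 1)) x) + ((t + 1 : k) * (2 * i - c + t)) • (E ^ t) x := by
  induction t with
  | zero =>
    have := hEF i x hx
    rw [sub_eq_iff_eq_add] at this
    simp [this, add_comm]
  | succ t ih =>
    rw [pow_succ' E (t + 1), Module.End.mul_apply, ih, map_add, map_smul, Module.End.mul_apply,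
      ← Module.End.mul_apply E (E ^ t), ← pow_succ']
    have := hEF _ _ (pow_raise_mem hE (t + 1) hx)
    rw [sub_eq_iff_eq_add] at this
    rw [this, add_comm (_ • _) (F _), add_assoc, ← add_smul]
    congr 2
    push_cast
    ring

/-- In the lower half, powers of the raising operator are injective. -/
theorem pow_raise_injective [CharZero k] (hE : ∀ i, ∀ x ∈ W i, E x ∈ W (i + 1))
    (hF : ∀ i, ∀ x ∈ W (i + 1), F x ∈ W i) (hF0 : ∀ x ∈ W 0, F x = 0)
    (hEF : ∀ i, ∀ x ∈ W i, E (F x) - F (E x) = (2 * (i : k) - c) • x)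
    (i t : ℕ) (hit : 2 * i + t ≤ c) (x : V) (hx : x ∈ W i) (h0 : (E ^ t) x = 0) : x = 0 := by
  induction i generalizing t x with
  | zero =>
    induction t with
    | zero => simpa using h0
    | succ t ih =>
      refine ih (by omega) ?_
      have h := pow_raise_lower hE hEF t hx
      rw [hF0 x hx, h0, map_zero, map_zero, zero_add] at h
      refine (smul_eq_zero.mp h.symm).resolve_left (mul_ne_zero (Nat.cast_add_one_ne_zero t) ?_)
      have : (2 * ((0 : ℕ) : k) - c + t) = -((c - t : ℕ) : k) := by
        rw [Nat.cast_sub (by omega)]; push_cast; ring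
      rw [this, neg_ne_zero, Nat.cast_ne_zero]
      omega
  | succ i ihi =>
    induction t with
    | zero => simpa using h0
    | succ t ih =>
      have h := pow_raise_lower hE hEF t hx
      -- `F x` lies one degree lower and is killed by `E ^ (t + 2)`; since `2i + (t + 2)` is still
      -- at most `c`, the outer induction applies.
      have hFx : F x = 0 := by
        refine ihi (t + 2) (by omega) (F x) (hF i x hx) ?_
        have h' := pow_raise_lower hE hEF (t + 1) hx
        rw [h', h0, smul_zero, add_zero, pow_succ', Module.End.mul_apply, h0, map_zero, map_zero]
      refine ih (by omega) ?_
      rw [hFx, h0, map_zero, map_zero, zero_add] at h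
      refine (smul_eq_zero.mp h.symm).resolve_left (mul_ne_zero (Nat.cast_add_one_ne_zero t) ?_)
      have : (2 * ((i + 1 : ℕ) : k) - c + t) = -((c - (2 * (i + 1) + t) : ℕ) : k) := by
        rw [Nat.cast_sub (by omega)]; push_cast; ring
      rw [this, neg_ne_zero, Nat.cast_ne_zero]
      omega

/-- At the top of a string the term containing `E x` disappears, so only the sum of the weights `2l
- c`, `l = i, …, i + q`, survives. -/
theorem raise_pow_lower_of_raise_eq_zero (hF : ∀ i, ∀ x ∈ W (i + 1), F x ∈ W i)
    (hEF : ∀ i, ∀ x ∈ W i, E (F x) - F (E x) = (2 * (i : k) - c) • x)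
    (q : ℕ) {i : ℕ} {x : V} (hx : x ∈ W (i + q)) (h0 : E x = 0) :
    E ((F ^ (q + 1)) x) = ((q + 1 : k) * (2 * (i + q) - c - q)) • (F ^ q) x := by
  induction q generalizing i with
  | zero =>
    have := hEF _ _ hx
    rw [h0, map_zero, sub_zero] at this
    simp [this]
  | succ q ih =>
    have h1 := hEF _ _ (pow_lower_mem hF (q + 1) hx)
    rw [sub_eq_iff_eq_add] at h1
    rw [pow_succ', Module.End.mul_apply, h1,
      ih (i := i + 1) (by rwa [add_right_comm, add_assoc]), map_smul,
      ← Module.End.mul_apply F (F ^ q), ← pow_succ', ← add_smul]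
    congr 1
    push_cast
    ring

/-- The scalar `κ` is a product of the factors from the preceding formula; `hc` makes each of them a
positive integer. -/
theorem pow_raise_pow_lower_of_raise_eq_zero [CharZero k]
    (hF : ∀ i, ∀ x ∈ W (i + 1), F x ∈ W i)
    (hEF : ∀ i, ∀ x ∈ W i, E (F x) - F (E x) = (2 * (i : k) - c) • x)
    (t : ℕ) {i : ℕ} {x : V} (hx : x ∈ W (i + t)) (h0 : E x = 0) (hc : c + t ≤ 2 * (i + t)) :
    ∃ κ : k, κ ≠ 0 ∧ (E ^ t) ((F ^ t) x) = κ • x := by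
  induction t generalizing i with
  | zero => exact ⟨1, one_ne_zero, by simp⟩
  | succ t ih =>
    have hx' : x ∈ W (i + 1 + t) := by rwa [add_assoc, add_comm 1 t]
    obtain ⟨κ, hκ, h⟩ := ih hx' (by omega)
    refine ⟨((t + 1 : k) * (2 * ((i + 1 : ℕ) + t) - c - t)) * κ, mul_ne_zero (mul_ne_zero ?_ ?_) hκ, ?_⟩
    · exact Nat.cast_add_one_ne_zero t
    · have : (2 * (((i + 1 : ℕ) : k) + t) - c - t) = ((2 * (i + 1 + t) - (c + t) : ℕ) : k) := by
        rw [Nat.cast_sub (by omega)]; push_cast; ring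
      rw [this, Nat.cast_ne_zero]
      omega
    · rw [pow_succ E, Module.End.mul_apply, raise_pow_lower_of_raise_eq_zero hF hEF t hx' h0,
        map_smul, h, smul_smul]

/-- In the upper half, powers of the raising operator are surjective. -/
theorem pow_raise_surjective [CharZero k] (hE : ∀ i, ∀ x ∈ W i, E x ∈ W (i + 1))
    (hF : ∀ i, ∀ x ∈ W (i + 1), F x ∈ W i)
    (hEF : ∀ i, ∀ x ∈ W i, E (F x) - F (E x) = (2 * (i : k) - c) • x)
    (hb : ∃ N, ∀ i, N ≤ i → W i = ⊥)
    (i t : ℕ) (hit : c ≤ 2 * i + t) (y : V) (hy : y ∈ W (i + t)) : ∃ x ∈ W i, (E ^ t) x = y := by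
  obtain ⟨N, hN⟩ := hb
  induction hn : N - (i + t) generalizing t y with
  | zero =>
    rw [hN _ (by omega), Submodule.mem_bot] at hy
    exact ⟨0, zero_mem _, by simp [hy]⟩
  | succ n ih =>
    -- Descending induction on the target degree: `E y` is already reached, so `y` can be corrected
    -- by `E ^ t u` to a vector killed by `E`.
    obtain ⟨u, hu, hu'⟩ := ih (t + 1) (by omega) (E y) (hE _ _ hy) (by omega)
    have hw : y - (E ^ t) u ∈ W (i + t) := sub_mem hy (pow_raise_mem hE t hu)
    have hw0 : E (y - (E ^ t) u) = 0 := by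
      rw [map_sub, ← Module.End.mul_apply, ← pow_succ', hu', sub_self]
    obtain ⟨κ, hκ, h⟩ := pow_raise_pow_lower_of_raise_eq_zero hF hEF t hw hw0 (by omega)
    refine ⟨u + κ⁻¹ • (F ^ t) (y - (E ^ t) u),
      add_mem hu (Submodule.smul_mem _ _ (pow_lower_mem hF t hw)), ?_⟩
    rw [map_add, map_smul, h, inv_smul_smul₀ hκ, add_sub_cancel]

end RaisingLowering

/-! ### Splitting off Jordan strings and building a lowering operator -/

section Strings

variable {k V : Type*} [Field k] [AddCommGroup V] [Module k V]

/-- A linear functional detecting a given nonzero homogeneous element, and vanishing in all other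
degrees. -/
theorem exists_homogeneous_dual (𝒱 : ℕ → Submodule k V) [DirectSum.Decomposition 𝒱]
    {b : ℕ} {w : V} (hw : w ∈ 𝒱 b) (hw0 : w ≠ 0) :
    ∃ φ : V →ₗ[k] k, φ w = 1 ∧ ∀ i, i ≠ b → ∀ x ∈ 𝒱 i, φ x = 0 := by
  have hw' : (⟨w, hw⟩ : 𝒱 b) ≠ 0 := fun h => hw0 (congrArg Subtype.val h)
  obtain ⟨f, hf⟩ := Module.Projective.exists_dual_ne_zero k hw'
  refine ⟨(f ⟨w, hw⟩)⁻¹ • (f ∘ₗ DirectSum.component k ℕ (fun i => 𝒱 i) b ∘ₗ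
    (DirectSum.decomposeLinearEquiv 𝒱).toLinearMap), ?_, ?_⟩
  · have : (DirectSum.decompose 𝒱 w) b = ⟨w, hw⟩ :=
      Subtype.ext (DirectSum.decompose_of_mem_same 𝒱 hw)
    change (f ⟨w, hw⟩)⁻¹ * f ((DirectSum.decompose 𝒱 w) b) = 1
    rw [this, inv_mul_cancel₀ hf]
  · intro i hi x hx
    have : (DirectSum.decompose 𝒱 x) b = 0 :=
      Subtype.ext (DirectSum.decompose_of_mem_ne 𝒱 hx hi)
    change (f ⟨w, hw⟩)⁻¹ * f ((DirectSum.decompose 𝒱 x) b) = 0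
    rw [this, map_zero, mul_zero]

theorem exists_homogeneous_apply_ne_zero (𝒱 : ℕ → Submodule k V) [DirectSum.Decomposition 𝒱]
    {U : Type*} [AddCommGroup U] [Module k U] {f : V →ₗ[k] U} (hf : f ≠ 0) :
    ∃ a, ∃ x ∈ 𝒱 a, f x ≠ 0 := by
  by_contra! h
  refine hf (LinearMap.ext fun x => ?_)
  induction x using DirectSum.Decomposition.inductionOn 𝒱 with
  | zero => simp
  | homogeneous m => simpa using h _ m m.2
  | add x y hx hy => simpa [hx] using hy

/-- The operator `x ↦ ∑ c_j φ(L^(r-j) x) u_j`. -/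
noncomputable def stringOperator (L : Module.End k V) (φ : V →ₗ[k] k) (r : ℕ) (c : ℕ → k)
    (u : ℕ → V) : Module.End k V :=
  ∑ j ∈ Finset.range (r + 1), c j • (φ ∘ₗ (L ^ (r - j))).smulRight (u j)

theorem stringOperator_apply (L : Module.End k V) (φ : V →ₗ[k] k) (r : ℕ) (c : ℕ → k)
    (u : ℕ → V) (x : V) :
    stringOperator L φ r c u x =
      ∑ j ∈ Finset.range (r + 1), (c j * φ ((L ^ (r - j)) x)) • u j := by
  simp [stringOperator, LinearMap.sum_apply, smul_smul]

/-- The data splitting a Jordan string off the image of the projection `ρ`. -/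
structure IsSplitString (𝒱 : ℕ → Submodule k V) (L ρ q F : Module.End k V) (a r : ℕ) : Prop where
  ne_zero : q ≠ 0
  mul_self : q * q = q
  mul_proj : q * ρ = q
  proj_mul : ρ * q = q
  comm : q * L = L * q
  map_mem : ∀ i, ∀ x ∈ 𝒱 i, q x ∈ 𝒱 i
  mul_lower : q * F = F
  lower_mul : F * q = F
  lower_zero : ∀ x ∈ 𝒱 0, F x = 0
  lower_mem : ∀ i, ∀ x ∈ 𝒱 (i + 1), F x ∈ 𝒱 i
  commutator : ∀ i, ∀ x ∈ 𝒱 i, L (F x) - F (L x) = (2 * (i : k) - (2 * a + r)) • q x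
  exists_bot : ∃ v ∈ 𝒱 a, v ≠ 0 ∧ (L ^ (r + 1)) v = 0
  exists_top : ∃ w ∈ 𝒱 (a + r), w ≠ 0 ∧ ∀ y, (L ^ (r + 1)) y ≠ w

theorem exists_isSplitString (𝒱 : ℕ → Submodule k V) [DirectSum.Decomposition 𝒱]
    {L ρ : Module.End k V} (hL : ∀ i, ∀ x ∈ 𝒱 i, L x ∈ 𝒱 (i + 1)) (hnil : IsNilpotent L)
    (hρ0 : ρ ≠ 0) (hρρ : ρ * ρ = ρ) (hρL : ρ * L = L * ρ) (hρ : ∀ i, ∀ x ∈ 𝒱 i, ρ x ∈ 𝒱 i) :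
    ∃ q F a r, IsSplitString 𝒱 L ρ q F a r := by
  classical
  -- The string has maximal length: `r + 1` is the nilpotency index of `L` on the range of `ρ`. This
  -- gives `φ ∘ L ^ (r + 1) = 0`, which lets the string split off compatibly with `L`.
  have hex : ∃ p, L ^ p * ρ = 0 := by
    obtain ⟨n, hn⟩ := hnil
    exact ⟨n, by rw [hn, zero_mul]⟩
  obtain ⟨r, hr⟩ : ∃ r, Nat.find hex = r + 1 := by
    refine Nat.exists_eq_succ_of_ne_zero fun h => hρ0 ?_
    simpa [h] using Nat.find_spec hex
  have hLr : L ^ (r + 1) * ρ = 0 := hr ▸ Nat.find_spec hex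
  have hLr' : L ^ r * ρ ≠ 0 := Nat.find_min hex (by omega)
  obtain ⟨a, x₀, hx₀, hne⟩ := exists_homogeneous_apply_ne_zero 𝒱 hLr'
  have hcomm : ∀ n, ρ * L ^ n = L ^ n * ρ := fun n =>
    (show Commute ρ L from hρL).pow_right n
  set v := ρ x₀ with hv
  have hva : v ∈ 𝒱 a := hρ a x₀ hx₀
  have hρv : ρ v = v := by rw [hv, ← Module.End.mul_apply, hρρ]
  have hLv : ∀ n, r < n → (L ^ n) v = 0 := by
    intro n hn
    obtain ⟨m, rfl⟩ := Nat.exists_eq_add_of_lt hn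
    rw [show r + m + 1 = m + (r + 1) by omega, pow_add, hv, Module.End.mul_apply,
      ← Module.End.mul_apply (L ^ (r + 1)), hLr]
    simp
  have hρLv : ∀ n, ρ ((L ^ n) v) = (L ^ n) v := by
    intro n
    rw [← Module.End.mul_apply, hcomm, Module.End.mul_apply, hρv]
  have hw : (L ^ r) v ∈ 𝒱 (a + r) := pow_raise_mem hL r hva
  obtain ⟨φ₀, hφ₀, hφ₀'⟩ := exists_homogeneous_dual 𝒱 hw hne
  set φ : V →ₗ[k] k := φ₀ ∘ₗ ρ with hφ
  have hφρ : ∀ x, φ (ρ x) = φ x := by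
    intro x
    rw [hφ, LinearMap.comp_apply, LinearMap.comp_apply, ← Module.End.mul_apply, hρρ]
  have hφ0 : ∀ i, i ≠ a + r → ∀ x ∈ 𝒱 i, φ x = 0 := fun i hi x hx => hφ₀' i hi _ (hρ i x hx)
  have hφL : ∀ x, φ ((L ^ (r + 1)) x) = 0 := by
    intro x
    rw [← hφρ, ← Module.End.mul_apply, hcomm, hLr]
    simp
  have hφL0 : ∀ n i, i + n ≠ a + r → ∀ x ∈ 𝒱 i, φ ((L ^ n) x) = 0 := fun n i hi x hx =>
    hφ0 _ hi _ (pow_raise_mem hL n hx)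
  have hφv : φ ((L ^ r) v) = 1 := by
    rw [hφ, LinearMap.comp_apply, hρLv]; exact hφ₀
  have hφv0 : ∀ n, n ≠ r → φ ((L ^ n) v) = 0 := fun n hn => hφL0 n a (by omega) v hva
  -- These are the standard `sl₂` coefficients: `c j - c (j + 1) = 2j - r`. As `c 0 = 0`, the
  -- truncated exponent `j - 1` at `j = 0` is harmless.
  set c : ℕ → k := fun j => (j : k) * (r + 1 - j) with hc
  set q := stringOperator L φ r (fun _ => 1) (fun j => (L ^ j) v) with hq
  set F := stringOperator L φ r c (fun j => (L ^ (j - 1)) v) with hF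
  have hqx : ∀ x, q x = ∑ j ∈ Finset.range (r + 1), φ ((L ^ (r - j)) x) • (L ^ j) v := by
    intro x; rw [hq, stringOperator_apply]; simp
  have hFx : ∀ x, F x =
      ∑ j ∈ Finset.range (r + 1), (c j * φ ((L ^ (r - j)) x)) • (L ^ (j - 1)) v :=
    fun x => stringOperator_apply _ _ _ _ _ _
  have hqL : ∀ j ≤ r, q ((L ^ j) v) = (L ^ j) v := by
    intro j hj
    rw [hqx, Finset.sum_eq_single_of_mem j (Finset.mem_range.mpr (by omega))]
    · rw [← Module.End.mul_apply, ← pow_add, Nat.sub_add_cancel hj, hφv, one_smul]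
    · intro i hi hij
      rw [Finset.mem_range] at hi
      rw [← Module.End.mul_apply, ← pow_add, hφv0 _ (by omega), zero_smul]
  have hφq : ∀ j ≤ r, ∀ x, φ ((L ^ (r - j)) (q x)) = φ ((L ^ (r - j)) x) := by
    intro j hj x
    rw [hqx, map_sum, map_sum, Finset.sum_eq_single_of_mem j (Finset.mem_range.mpr (by omega))]
    · rw [map_smul, map_smul, ← Module.End.mul_apply (L ^ (r - j)) (L ^ j), ← pow_add,
        Nat.sub_add_cancel hj, hφv, smul_eq_mul, mul_one]
    · intro i hi hij
      rw [Finset.mem_range] at hi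
      rw [map_smul, map_smul, ← Module.End.mul_apply (L ^ (r - j)) (L ^ i), ← pow_add,
        hφv0 _ (by omega), smul_zero]
  have hv0 : v ≠ 0 := by
    rintro h
    rw [h, map_zero, map_zero] at hφv
    exact zero_ne_one hφv
  refine ⟨q, F, a, r, ?_, ?_, ?_, ?_, ?_, ?_, ?_, ?_, ?_, ?_, ?_, ?_, ?_⟩
  · intro h
    have := hqL 0 (Nat.zero_le _)
    rw [h] at this
    exact hv0 (by simpa using this.symm)
  · ext x
    rw [Module.End.mul_apply, hqx x, map_sum]
    refine Finset.sum_congr rfl fun j hj => ?_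
    rw [map_smul, hqL j (by simpa [Nat.lt_succ_iff] using hj)]
  · ext x
    rw [Module.End.mul_apply, hqx, hqx]
    refine Finset.sum_congr rfl fun j hj => ?_
    rw [← Module.End.mul_apply (L ^ (r - j)), ← hcomm, Module.End.mul_apply, hφρ]
  · ext x
    rw [Module.End.mul_apply, hqx x, map_sum]
    refine Finset.sum_congr rfl fun j hj => ?_
    rw [map_smul, hρLv]
  -- Commuting with `L` is a shift of index; the boundary terms die because `L ^ (r + 1) v = 0` and
  -- `φ ∘ L ^ (r + 1) = 0`.
  · ext x
    rw [Module.End.mul_apply, Module.End.mul_apply, hqx, hqx, Finset.sum_range_succ', map_sum,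
      Finset.sum_range_succ, map_smul, ← Module.End.mul_apply L (L ^ r), ← pow_succ',
      hLv (r + 1) (by omega), smul_zero, add_zero, Nat.sub_zero,
      ← Module.End.mul_apply (L ^ r) L, ← pow_succ, hφL, zero_smul, add_zero]
    refine Finset.sum_congr rfl fun j hj => ?_
    rw [Finset.mem_range] at hj
    rw [map_smul, ← Module.End.mul_apply _ L, ← pow_succ, ← Module.End.mul_apply L (L ^ j),
      ← pow_succ', show r - (j + 1) + 1 = r - j by omega]
  · intro i x hx
    rw [hqx]
    refine Submodule.sum_mem _ fun j hj => ?_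
    rw [Finset.mem_range] at hj
    by_cases h : i + (r - j) = a + r
    · rw [show i = a + j by omega]
      exact Submodule.smul_mem _ _ (pow_raise_mem hL j hva)
    · rw [hφL0 _ _ h x hx, zero_smul]
      exact zero_mem _
  · ext x
    rw [Module.End.mul_apply, hFx x, map_sum]
    refine Finset.sum_congr rfl fun j hj => ?_
    rw [Finset.mem_range] at hj
    rw [map_smul, hqL (j - 1) (by omega)]
  · ext x
    rw [Module.End.mul_apply, hFx, hFx]
    refine Finset.sum_congr rfl fun j hj => ?_
    rw [Finset.mem_range] at hj
    rw [hφq j (by omega)]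
  · intro x hx
    rw [hFx]
    refine Finset.sum_eq_zero fun j hj => ?_
    rw [Finset.mem_range] at hj
    by_cases h : 0 + (r - j) = a + r
    · rw [show j = 0 by omega]
      simp [hc]
    · rw [hφL0 _ _ h x hx, mul_zero, zero_smul]
  · intro i x hx
    rw [hFx]
    refine Submodule.sum_mem _ fun j hj => ?_
    rw [Finset.mem_range] at hj
    by_cases h : i + 1 + (r - j) = a + r
    · obtain rfl | hj0 := Nat.eq_zero_or_pos j
      · simp [hc]
      · rw [show i = a + (j - 1) by omega]
        exact Submodule.smul_mem _ _ (pow_raise_mem hL (j - 1) hva)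
    · rw [hφL0 _ _ h x hx, mul_zero, zero_smul]
      exact zero_mem _
  · intro i x hx
    have h1 : L (F x) = ∑ j ∈ Finset.range (r + 1),
        (c j * φ ((L ^ (r - j)) x)) • (L ^ j) v := by
      rw [hFx, map_sum]
      refine Finset.sum_congr rfl fun j hj => ?_
      obtain rfl | hj0 := Nat.eq_zero_or_pos j
      · simp [hc]
      · rw [map_smul, ← Module.End.mul_apply L, ← pow_succ', Nat.sub_add_cancel hj0]
    have h2 : F (L x) = ∑ j ∈ Finset.range (r + 1),
        (c (j + 1) * φ ((L ^ (r - j)) x)) • (L ^ j) v := by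
      rw [hFx, Finset.sum_range_succ', Finset.sum_range_succ _ r]
      congr 1
      · refine Finset.sum_congr rfl fun j hj => ?_
        rw [Finset.mem_range] at hj
        rw [← Module.End.mul_apply _ L, ← pow_succ, show r - (j + 1) + 1 = r - j by omega,
          Nat.add_sub_cancel]
      · simp [hc]
    rw [h1, h2, hqx, ← Finset.sum_sub_distrib, Finset.smul_sum]
    refine Finset.sum_congr rfl fun j hj => ?_
    rw [Finset.mem_range] at hj
    rw [← sub_smul, smul_smul]
    by_cases h : i + (r - j) = a + r
    · rw [show i = a + j by omega, ← sub_mul]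
      congr 2
      simp only [hc]
      push_cast
      ring
    · rw [hφL0 _ _ h x hx, mul_zero, mul_zero, mul_zero, sub_zero]
  · exact ⟨v, hva, hv0, hLv _ (by omega)⟩
  · refine ⟨_, hw, hne, fun y hy => one_ne_zero (α := k) ?_⟩
    rw [← hφv, ← hy, hφL]

/-- The two-center Lefschetz condition: `L ^ t : V_i → V_{i+t}` is injective for `2 i + t ≤ C` and
surjective for `2 i + t ≥ C + 1`. -/
structure IsNearlyLefschetz (𝒱 : ℕ → Submodule k V) (L : Module.End k V) (C : ℕ) : Prop where
  map_mem : ∀ i, ∀ x ∈ 𝒱 i, L x ∈ 𝒱 (i + 1)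
  inj : ∀ i t, 2 * i + t ≤ C → ∀ x ∈ 𝒱 i, (L ^ t) x = 0 → x = 0
  surj : ∀ i t, C + 1 ≤ 2 * i + t → ∀ y ∈ 𝒱 (i + t), ∃ x ∈ 𝒱 i, (L ^ t) x = y
  eq_bot : ∀ i, C + 2 ≤ i → 𝒱 i = ⊥

theorem IsNearlyLefschetz.isNilpotent {𝒱 : ℕ → Submodule k V} [DirectSum.Decomposition 𝒱]
    {L : Module.End k V} {C : ℕ} (h : IsNearlyLefschetz 𝒱 L C) : IsNilpotent L := by
  refine ⟨C + 2, ?_⟩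
  by_contra hne
  obtain ⟨a, x, hx, hne'⟩ := exists_homogeneous_apply_ne_zero 𝒱 hne
  have := pow_raise_mem h.map_mem (C + 2) hx
  rw [h.eq_bot _ (by omega), Submodule.mem_bot] at this
  exact hne' this

/-- A lowering operator on the image of a projection `ρ`, with strings centered at `C` and, on the
image of `π`, at `C + 1`. -/
structure IsLowering (𝒱 : ℕ → Submodule k V) (L ρ F π : Module.End k V) (C : ℕ) : Prop where
  lower_proj : F * ρ = F
  proj_lower : ρ * F = F
  mul_proj : π * ρ = π
  proj_mul : ρ * π = π
  mul_self : π * π = π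
  comm : π * L = L * π
  comm_lower : π * F = F * π
  map_mem : ∀ i, ∀ x ∈ 𝒱 i, π x ∈ 𝒱 i
  lower_zero : ∀ x ∈ 𝒱 0, F x = 0
  lower_mem : ∀ i, ∀ x ∈ 𝒱 (i + 1), F x ∈ 𝒱 i
  commutator : ∀ i, ∀ x ∈ 𝒱 i, L (F x) - F (L x) = (2 * (i : k) - C) • ρ x - π x

/-- Strings are split off one at a time, by induction on the rank of `ρ`. The bottom of a string is
killed by `L ^ (r + 1)`, which contradicts injectivity if `2a + r < C`; its top is outside the range
of `L ^ (r + 1)`, which contradicts surjectivity if `2a + r > C + 1`. -/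
theorem IsNearlyLefschetz.exists_isLowering {𝒱 : ℕ → Submodule k V} [DirectSum.Decomposition 𝒱]
    [FiniteDimensional k V] {L : Module.End k V} {C : ℕ} (h : IsNearlyLefschetz 𝒱 L C)
    (ρ : Module.End k V) (hρρ : ρ * ρ = ρ) (hρL : ρ * L = L * ρ)
    (hρ : ∀ i, ∀ x ∈ 𝒱 i, ρ x ∈ 𝒱 i) :
    ∃ F π, IsLowering 𝒱 L ρ F π C := by
  induction hn : Module.finrank k (LinearMap.range ρ) using Nat.strong_induction_on
    generalizing ρ with
  | _ n ih =>
  by_cases hρ0 : ρ = 0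
  · subst hρ0
    exact ⟨0, 0, by constructor <;> simp⟩
  obtain ⟨q, G, a, r, S⟩ := exists_isSplitString 𝒱 h.map_mem h.isNilpotent hρ0 hρρ hρL hρ
  have hqρ' : q * (ρ - q) = 0 := by rw [mul_sub, S.mul_proj, S.mul_self, sub_self]
  have hρ'q : (ρ - q) * q = 0 := by rw [sub_mul, S.proj_mul, S.mul_self, sub_self]
  have hρ'ρ' : (ρ - q) * (ρ - q) = ρ - q := by
    rw [sub_mul, hqρ', sub_zero, mul_sub, hρρ, S.proj_mul]
  have hlt : Module.finrank k (LinearMap.range (ρ - q)) < n := by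
    rw [← hn]
    refine Submodule.finrank_lt_finrank_of_lt (lt_of_le_of_ne ?_ ?_)
    · rintro _ ⟨x, rfl⟩
      refine ⟨(ρ - q) x, ?_⟩
      rw [← Module.End.mul_apply, mul_sub, hρρ, S.proj_mul]
    · intro heq
      refine S.ne_zero (LinearMap.ext fun x => ?_)
      have hx : q x ∈ LinearMap.range ρ := ⟨q x, by rw [← Module.End.mul_apply, S.proj_mul]⟩
      rw [← heq] at hx
      obtain ⟨y, hy⟩ := hx
      rw [← S.mul_self, Module.End.mul_apply, ← hy, ← Module.End.mul_apply, hqρ']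
      rfl
  obtain ⟨F', π', I⟩ := ih _ hlt (ρ - q) hρ'ρ' (by rw [sub_mul, mul_sub, hρL, S.comm])
    (fun i x hx => sub_mem (hρ i x hx) (S.map_mem i x hx)) rfl
  have hC : 2 * a + r = C ∨ 2 * a + r = C + 1 := by
    obtain ⟨v, hv, hv0, hLv⟩ := S.exists_bot
    obtain ⟨w, hw, hw0, hLw⟩ := S.exists_top
    have h1 : C ≤ 2 * a + r := by
      by_contra! hlt
      exact hv0 (h.inj a (r + 1) (by omega) v hv hLv)
    have h2 : 2 * a + r ≤ C + 1 := by
      by_contra! hlt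
      -- A string starting in degree `0` has no degree `a - 1` to be hit from; the vanishing of high
      -- degrees replaces surjectivity there.
      obtain rfl | ha := Nat.eq_zero_or_pos a
      · rw [h.eq_bot _ (by omega)] at hw
        exact hw0 hw
      · obtain ⟨b, rfl⟩ := Nat.exists_eq_succ_of_ne_zero ha.ne'
        obtain ⟨y, -, hy⟩ := h.surj b (r + 1) (by omega) w
          (by rwa [Nat.succ_add, Nat.succ_eq_add_one, add_assoc] at hw)
        exact hLw y hy
    omega
  -- `ε` records which center the string has, and hence whether its projection `q` enters `π`.
  obtain ⟨ε, hε, hεC⟩ : ∃ ε : k, ε * ε = ε ∧ (2 * (a : k) + r) = C + ε := by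
    rcases hC with hC | hC
    · exact ⟨0, by simp, by rw [← hC]; push_cast; ring⟩
    · exact ⟨1, by simp, by
        have := congrArg (Nat.cast (R := k)) hC
        push_cast at this
        exact this⟩
  have e1 : q * F' = 0 := by rw [← I.proj_lower, ← mul_assoc, hqρ', zero_mul]
  have e2 : F' * q = 0 := by rw [← I.lower_proj, mul_assoc, hρ'q, mul_zero]
  have e3 : q * π' = 0 := by rw [← I.proj_mul, ← mul_assoc, hqρ', zero_mul]
  have e4 : π' * q = 0 := by rw [← I.mul_proj, mul_assoc, hρ'q, mul_zero]
  have e5 : π' * G = 0 := by rw [← S.mul_lower, ← mul_assoc, e4, zero_mul]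
  have e6 : G * π' = 0 := by rw [← S.lower_mul, mul_assoc, e3, mul_zero]
  have e7 : G * ρ = G := by rw [← S.lower_mul, mul_assoc, S.mul_proj]
  have e8 : ρ * G = G := by rw [← S.mul_lower, ← mul_assoc, S.proj_mul]
  have hρρ' : ρ = (ρ - q) + q := by abel
  have e9 : F' * ρ = F' := by rw [hρρ', mul_add, I.lower_proj, e2, add_zero]
  have e10 : ρ * F' = F' := by rw [hρρ', add_mul, I.proj_lower, e1, add_zero]
  have e11 : π' * ρ = π' := by rw [hρρ', mul_add, I.mul_proj, e4, add_zero]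
  have e12 : ρ * π' = π' := by rw [hρρ', add_mul, I.proj_mul, e3, add_zero]
  refine ⟨G + F', ε • q + π', ?_, ?_, ?_, ?_, ?_, ?_, ?_, ?_, ?_, ?_, ?_⟩
  · rw [add_mul, e7, e9]
  · rw [mul_add, e8, e10]
  · rw [add_mul, smul_mul_assoc, S.mul_proj, e11]
  · rw [mul_add, mul_smul_comm, S.proj_mul, e12]
  · rw [add_mul, mul_add, mul_add, smul_mul_smul_comm, S.mul_self, hε, smul_mul_assoc, e3,
      mul_smul_comm, e4, I.mul_self]
    simp
  · rw [add_mul, mul_add, smul_mul_assoc, mul_smul_comm, S.comm, I.comm]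
  · simp only [add_mul, mul_add, smul_mul_assoc, mul_smul_comm, S.mul_lower, S.lower_mul,
      e1, e2, e5, e6, I.comm_lower, smul_zero, add_zero, zero_add]
  · exact fun i x hx => add_mem (Submodule.smul_mem _ _ (S.map_mem i x hx)) (I.map_mem i x hx)
  · intro x hx
    rw [LinearMap.add_apply, S.lower_zero x hx, I.lower_zero x hx, add_zero]
  · exact fun i x hx => add_mem (S.lower_mem i x hx) (I.lower_mem i x hx)
  · intro i x hx
    have h1 := S.commutator i x hx
    have h2 := I.commutator i x hx
    rw [LinearMap.add_apply, LinearMap.add_apply, map_add, add_sub_add_comm, h1, h2, hεC,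
      LinearMap.sub_apply, LinearMap.add_apply, LinearMap.smul_apply]
    module

end Strings

/-! ### The lowering operator of a monomial complete intersection -/

section MonomialCompleteIntersection

open MvPolynomial

variable (k : Type*) [Field k] {n : ℕ} (d : Fin n → ℕ)

/-- The ideal generated by the powers `x_i ^ d_i`. -/
noncomputable abbrev powIdeal : Ideal (MvPolynomial (Fin n) k) :=
  Ideal.span (Set.range fun i : Fin n => (X i : MvPolynomial (Fin n) k) ^ d i)

/-- The class of the variable `x_i` in the monomial complete intersection. -/
noncomputable def ciX (i : Fin n) : MonomialCI k d :=
  Ideal.Quotient.mkₐ k (powIdeal k d) (X i)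

variable {d}

theorem ciX_pow (i : Fin n) : ciX k d i ^ d i = 0 := by
  rw [ciX, ← map_pow, Ideal.Quotient.mkₐ_eq_mk, Ideal.Quotient.eq_zero_iff_mem]
  exact Ideal.subset_span ⟨i, rfl⟩

theorem mem_monomialCIGrading {m : ℕ} {y : MonomialCI k d} :
    y ∈ monomialCIGrading k d m ↔ ∃ f : MvPolynomial (Fin n) k, f.IsHomogeneous m ∧
      Ideal.Quotient.mkₐ k (powIdeal k d) f = y :=
  Iff.rfl

theorem mk_mem_monomialCIGrading {m : ℕ} {f : MvPolynomial (Fin n) k} (hf : f.IsHomogeneous m) :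
    Ideal.Quotient.mkₐ k (powIdeal k d) f ∈ monomialCIGrading k d m :=
  ⟨f, hf, rfl⟩

theorem ciX_mem (i : Fin n) : ciX k d i ∈ monomialCIGrading k d 1 :=
  mk_mem_monomialCIGrading k (isHomogeneous_X k i)

theorem monomialCIGrading_mul_mem {m m' : ℕ} {y y' : MonomialCI k d}
    (hy : y ∈ monomialCIGrading k d m) (hy' : y' ∈ monomialCIGrading k d m') :
    y * y' ∈ monomialCIGrading k d (m + m') := by
  obtain ⟨f, hf, rfl⟩ := (mem_monomialCIGrading k).mp hy
  obtain ⟨f', hf', rfl⟩ := (mem_monomialCIGrading k).mp hy'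
  exact (mem_monomialCIGrading k).mpr ⟨f * f', hf.mul hf', map_mul _ _ _⟩

theorem monomialCIGrading_eq_bot {m : ℕ} (hm : ∑ i, (d i - 1) < m) :
    monomialCIGrading k d m = ⊥ := by
  rw [eq_bot_iff]
  intro y hy
  obtain ⟨f, hf, rfl⟩ := (mem_monomialCIGrading k).mp hy
  rw [Submodule.mem_bot, Ideal.Quotient.mkₐ_eq_mk, Ideal.Quotient.eq_zero_iff_mem,
    f.as_sum]
  refine Ideal.sum_mem _ fun e he => ?_
  have hdeg : ∑ i, e i = m := by
    have := hf (mem_support_iff.mp he)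
    simpa [Finsupp.weight_apply, Finsupp.sum_fintype] using this
  obtain ⟨i, hi⟩ : ∃ i, d i ≤ e i := by
    by_contra! h
    have : ∑ i, e i ≤ ∑ i, (d i - 1) := Finset.sum_le_sum fun i _ => by
      have := h i
      omega
    omega
  have : monomial e (coeff e f) = monomial (e - Finsupp.single i (d i)) (coeff e f) * X i ^ d i := by
    rw [X_pow_eq_monomial, monomial_mul, mul_one, tsub_add_cancel_of_le]
    rwa [Finsupp.single_le_iff]
  rw [this]
  exact Ideal.mul_mem_left _ _ (Ideal.subset_span ⟨i, rfl⟩)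

theorem pderiv_eq_zero_of_isHomogeneous_zero {f : MvPolynomial (Fin n) k}
    (hf : f.IsHomogeneous 0) (i : Fin n) : pderiv i f = 0 := by
  rw [← totalDegree_zero_iff_isHomogeneous, totalDegree_eq_zero_iff_eq_C] at hf
  rw [hf, pderiv_C]

/-- The operator `∑ ((d_i - 1) ∂_i - x_i ∂_i ^ 2)` on polynomials. -/
noncomputable def polyLower (d : Fin n → ℕ) : Module.End k (MvPolynomial (Fin n) k) :=
  ∑ i, (((d i : k) - 1) • (pderiv i).toLinearMap -
    LinearMap.mulLeft k (X i) ∘ₗ (pderiv i).toLinearMap ∘ₗ (pderiv i).toLinearMap)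

theorem polyLower_apply (f : MvPolynomial (Fin n) k) :
    polyLower k d f =
      ∑ i, (((d i : k) - 1) • pderiv i f - X i * pderiv i (pderiv i f)) := by
  simp [polyLower, LinearMap.sum_apply]

theorem polyLower_X_mul (j : Fin n) (f : MvPolynomial (Fin n) k) :
    X j * polyLower k d f - polyLower k d (X j * f) =
      (2 : k) • (X j * pderiv j f) - ((d j : k) - 1) • f := by
  rw [polyLower_apply, polyLower_apply, Finset.mul_sum, ← Finset.sum_sub_distrib,
    Finset.sum_eq_single j]
  · rw [pderiv_mul, pderiv_X_self, one_mul, map_add, pderiv_mul, pderiv_X_self]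
    simp only [smul_eq_C_mul, map_sub, map_one, map_natCast, map_ofNat]
    ring
  · intro i _ hij
    rw [pderiv_mul, pderiv_X_of_ne hij.symm, zero_mul, zero_add, pderiv_mul,
      pderiv_X_of_ne hij.symm]
    simp only [smul_eq_C_mul]
    ring
  · simp

theorem polyLower_commutator {m : ℕ} {f : MvPolynomial (Fin n) k} (hf : f.IsHomogeneous m)
    (hd : ∀ i, 1 ≤ d i) :
    (∑ j, X j) * polyLower k d f - polyLower k d ((∑ j, X j) * f) =
      (2 * (m : k) - (∑ i, (d i - 1) : ℕ)) • f := by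
  rw [Finset.sum_mul, Finset.sum_mul, map_sum, ← Finset.sum_sub_distrib]
  simp only [polyLower_X_mul]
  rw [Finset.sum_sub_distrib, ← Finset.smul_sum, hf.sum_X_mul_pderiv, ← Finset.sum_smul, sub_smul,
    mul_smul, Nat.cast_smul_eq_nsmul, Nat.cast_sum]
  congr 2
  refine Finset.sum_congr rfl fun i _ => ?_
  rw [Nat.cast_sub (hd i), Nat.cast_one]

/-- Applied to `c x^d`, the terms in which no derivative falls on `c` are `(d - 1) d x^(d-1) c` and
`-d (d - 1) x^(d-1) c`. They cancel, and the remaining terms are divisible by `x^d`; this is why the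
coefficient of `∂` is `d - 1`. -/
theorem polyLower_mem (hd : ∀ i, 1 ≤ d i) {f : MvPolynomial (Fin n) k}
    (hf : f ∈ powIdeal k d) : polyLower k d f ∈ powIdeal k d := by
  obtain ⟨c, rfl⟩ := Ideal.mem_span_range_iff_exists_fun.mp hf
  rw [map_sum]
  refine Ideal.sum_mem _ fun j _ => ?_
  rw [polyLower_apply]
  refine Ideal.sum_mem _ fun i _ => ?_
  have hj : (X j : MvPolynomial (Fin n) k) ^ d j ∈ powIdeal k d := Ideal.subset_span ⟨j, rfl⟩
  suffices ∃ g, ((d i : k) - 1) • pderiv i (c j * X j ^ d j) -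
      X i * pderiv i (pderiv i (c j * X j ^ d j)) = g * X j ^ d j by
    obtain ⟨g, hg⟩ := this
    rw [hg]
    exact Ideal.mul_mem_left _ _ hj
  by_cases hij : i = j
  · subst hij
    refine ⟨((d i : k) - 1) • pderiv i (c i) - 2 * (d i : MvPolynomial (Fin n) k) * pderiv i (c i) -
      X i * pderiv i (pderiv i (c i)), ?_⟩
    obtain ⟨e, he⟩ : ∃ e, d i = e + 1 := ⟨d i - 1, by have := hd i; omega⟩
    rw [he]
    -- The exponents `d - 1` and `d - 2` are truncated subtractions, so `d = 1` is treated apart.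
    obtain rfl | ⟨e', rfl⟩ : e = 0 ∨ ∃ e', e = e' + 1 := by
      cases e
      · exact Or.inl rfl
      · exact Or.inr ⟨_, rfl⟩
    · simp only [pderiv_mul, pderiv_pow, pderiv_X_self, map_add, smul_eq_C_mul, map_sub, map_one,
        map_natCast]
      simp
      ring
    · simp only [pderiv_mul, pderiv_pow, pderiv_X_self, map_add, smul_eq_C_mul, map_sub, map_one,
        map_natCast, Nat.add_sub_cancel, Derivation.map_natCast, pderiv_one]
      push_cast
      ring
  · refine ⟨((d i : k) - 1) • pderiv i (c j) - X i * pderiv i (pderiv i (c j)), ?_⟩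
    have h0 : pderiv i ((X j : MvPolynomial (Fin n) k) ^ d j) = 0 := by
      rw [pderiv_pow, pderiv_X_of_ne (Ne.symm hij), mul_zero]
    simp only [pderiv_mul, h0, mul_zero, add_zero, smul_eq_C_mul]
    ring

/-- The operator `polyLower` descends because it preserves the ideal; the linear section `σ` used to
define `G` therefore does not matter. -/
theorem exists_ciLower (hd : ∀ i, 1 ≤ d i) :
    ∃ G : Module.End k (MonomialCI k d),
      (∀ y ∈ monomialCIGrading k d 0, G y = 0) ∧
      (∀ m, ∀ y ∈ monomialCIGrading k d (m + 1), G y ∈ monomialCIGrading k d m) ∧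
      ∀ m, ∀ y ∈ monomialCIGrading k d m,
        (∑ i, ciX k d i) * G y - G ((∑ i, ciX k d i) * y) =
          (2 * (m : k) - (∑ i, (d i - 1) : ℕ)) • y := by
  set Q := Ideal.Quotient.mkₐ k (powIdeal k d) with hQ
  have hsurj : Function.Surjective Q := Ideal.Quotient.mkₐ_surjective k _
  obtain ⟨σ, hσ⟩ := Q.toLinearMap.exists_rightInverse_of_surjective
    (LinearMap.range_eq_top.mpr hsurj)
  set G : Module.End k (MonomialCI k d) := Q.toLinearMap ∘ₗ polyLower k d ∘ₗ σ with hG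
  have hGQ : ∀ f, G (Q f) = Q (polyLower k d f) := by
    intro f
    change Q (polyLower k d (σ (Q f))) = Q (polyLower k d f)
    rw [← sub_eq_zero, ← map_sub, ← map_sub, hQ, Ideal.Quotient.mkₐ_eq_mk,
      Ideal.Quotient.eq_zero_iff_mem]
    refine polyLower_mem k hd ?_
    rw [← Ideal.Quotient.eq_zero_iff_mem, map_sub, sub_eq_zero]
    exact LinearMap.congr_fun hσ (Q f)
  have hhom : ∀ m (f : MvPolynomial (Fin n) k), f.IsHomogeneous m →
      (polyLower k d f).IsHomogeneous (m - 1) := by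
    intro m f hf
    rw [polyLower_apply]
    refine IsHomogeneous.sum _ _ _ fun i _ => ?_
    refine ((homogeneousSubmodule _ _ _).smul_mem _ hf.pderiv :
      (((d i : k) - 1) • pderiv i f).IsHomogeneous (m - 1)).sub ?_
    -- For `m ≤ 1` the degree count `1 + (m - 1 - 1)` is wrong, but then `∂f` is constant and the
    -- second derivative vanishes.
    obtain hm | hm := Nat.lt_or_ge 1 m
    · have := (isHomogeneous_X k i).mul ((hf.pderiv (i := i)).pderiv (i := i)) 
      rwa [show 1 + (m - 1 - 1) = m - 1 by omega] at this
    · have h0 : (pderiv i f).IsHomogeneous 0 := by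
        have := hf.pderiv (i := i)
        rwa [show m - 1 = 0 by omega] at this
      rw [pderiv_eq_zero_of_isHomogeneous_zero k h0, mul_zero]
      exact isHomogeneous_zero _ _ _
  refine ⟨G, ?_, ?_, ?_⟩
  · intro y hy
    obtain ⟨f, hf, rfl⟩ := (mem_monomialCIGrading k).mp hy
    rw [← hQ, hGQ, polyLower_apply]
    simp [pderiv_eq_zero_of_isHomogeneous_zero k hf]
  · intro m y hy
    obtain ⟨f, hf, rfl⟩ := (mem_monomialCIGrading k).mp hy
    rw [← hQ, hGQ]
    exact mk_mem_monomialCIGrading k (hhom _ _ hf)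
  · intro m y hy
    obtain ⟨f, hf, rfl⟩ := (mem_monomialCIGrading k).mp hy
    have : (∑ i, ciX k d i) = Q (∑ i, X i) := by rw [map_sum]; rfl
    rw [← hQ, this, hGQ, ← map_mul, ← map_mul, hGQ, ← map_sub, polyLower_commutator k hf hd,
      map_smul]

end MonomialCompleteIntersection

/-! ### Full rank with two adjacent centers -/

section NearlyCentered

variable {k V : Type*} [Field k] [CharZero k] [AddCommGroup V] [Module k V]

/-- The raising operator of an `sl₂`-type action with two adjacent centers has powers of full
rank. -/
theorem pow_raise_injOn_or_surjOn {U : ℕ → Submodule k V} {E H P : Module.End k V} {c : ℕ}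
    (hPE : P * E = E * P) (hPH : P * H = H * P) (hPP : P * P = P)
    (hEmem : ∀ m, ∀ z ∈ U m, E z ∈ U (m + 1)) (hHmem : ∀ m, ∀ z ∈ U (m + 1), H z ∈ U m)
    (hH0 : ∀ z ∈ U 0, H z = 0) (hPmem : ∀ m, ∀ z ∈ U m, P z ∈ U m)
    (hEH : ∀ m, ∀ z ∈ U m, E (H z) - H (E z) = (2 * (m : k) - c) • z - P z)
    (hbot : ∃ N, ∀ m, N ≤ m → U m = ⊥) (t m : ℕ) :
    Set.InjOn (fun z => (E ^ t) z) (U m) ∨ Set.SurjOn (fun z => (E ^ t) z) (U m) (U (m + t)) := by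
  -- `W ε` is the part where `P = ε`; there the relation has the single center `c + ε`. Only `ε = 0,
  -- 1` are needed, since `P` is idempotent.
  set W : ℕ → ℕ → Submodule k V := fun ε m =>
    U m ⊓ LinearMap.eqLocus P ((ε : k) • LinearMap.id) with hW
  have hWmem : ∀ ε m z, z ∈ W ε m ↔ z ∈ U m ∧ P z = (ε : k) • z :=
    fun ε m z => Iff.rfl
  have hWE : ∀ ε m, ∀ z ∈ W ε m, E z ∈ W ε (m + 1) := by
    intro ε m z hz
    rw [hWmem] at hz ⊢
    refine ⟨hEmem m z hz.1, ?_⟩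
    rw [← Module.End.mul_apply, hPE, Module.End.mul_apply, hz.2, map_smul]
  have hWH : ∀ ε m, ∀ z ∈ W ε (m + 1), H z ∈ W ε m := by
    intro ε m z hz
    rw [hWmem] at hz ⊢
    refine ⟨hHmem m z hz.1, ?_⟩
    rw [← Module.End.mul_apply, hPH, Module.End.mul_apply, hz.2, map_smul]
  have hWEH : ∀ ε m, ∀ z ∈ W ε m,
      E (H z) - H (E z) = (2 * (m : k) - (c + ε : ℕ)) • z := by
    intro ε m z hz
    rw [hEH m z hz.1, ((hWmem ε m z).mp hz).2]
    push_cast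
    module
  have hWbot : ∀ ε, ∃ N, ∀ m, N ≤ m → W ε m = ⊥ := fun ε => by
    obtain ⟨N, hN⟩ := hbot
    exact ⟨N, fun m hm => by simp only [hW]; rw [hN m hm, bot_inf_eq]⟩
  have hsplit : ∀ m, ∀ z ∈ U m, P z ∈ W 1 m ∧ z - P z ∈ W 0 m := by
    intro m z hz
    have hPPz : P (P z) = P z := LinearMap.congr_fun hPP z
    refine ⟨(hWmem _ _ _).mpr ⟨hPmem m z hz, ?_⟩,
      (hWmem _ _ _).mpr ⟨sub_mem hz (hPmem m z hz), ?_⟩⟩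
    · simp [hPPz]
    · simp [hPPz]
  have hPEt : ∀ t z, P ((E ^ t) z) = (E ^ t) (P z) := fun t z =>
    LinearMap.congr_fun ((show Commute P E from hPE).pow_right t) z
  -- Adjacency of the centers matters here: `2m + t > c` means `2m + t ≥ c + 1`, so both eigenparts
  -- fall on the same side.
  rcases Nat.lt_or_ge c (2 * m + t) with hlt | hge
  · right
    intro y hy
    obtain ⟨h1, h0⟩ := hsplit _ y hy
    obtain ⟨u, hu, hu'⟩ := pow_raise_surjective (hWE 1) (hWH 1) (hWEH 1) (hWbot 1) m t
      (by omega) _ h1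
    obtain ⟨v, hv, hv'⟩ := pow_raise_surjective (hWE 0) (hWH 0) (hWEH 0) (hWbot 0) m t
      (by omega) _ h0
    refine ⟨u + v, add_mem hu.1 hv.1, ?_⟩
    simp only [map_add, hu', hv']
    abel
  · left
    have key : ∀ z ∈ U m, (E ^ t) z = 0 → z = 0 := by
      intro z hz hz0
      obtain ⟨h1, h0⟩ := hsplit _ z hz
      have h3 := pow_raise_injective (hWE 1) (hWH 1) (fun z hz => hH0 z hz.1) (hWEH 1) m t
        (by omega) _ h1 (by rw [← hPEt, hz0, map_zero])
      have h4 := pow_raise_injective (hWE 0) (hWH 0) (fun z hz => hH0 z hz.1) (hWEH 0) m t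
        (by omega) _ h0 (by rw [map_sub, ← hPEt, hz0, map_zero, sub_zero])
      rwa [h3, sub_zero] at h4
    intro y hy z hz hyz
    exact sub_eq_zero.mp (key _ (sub_mem hy hz) (by rw [map_sub, sub_eq_zero]; exact hyz))

end NearlyCentered

/-! ### Tensor products of algebras with lowering operators -/

section TensorGrading

variable {k A C : Type*} [Field k] [CommRing A] [Algebra k A] [CommRing C] [Algebra k C]
  {𝒜 : ℕ → Submodule k A} {𝒞 : ℕ → Submodule k C}

theorem tmul_mem_tensorGrading {i j m : ℕ} (h : i + j = m) {a : A} {c : C} (ha : a ∈ 𝒜 i)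
    (hc : c ∈ 𝒞 j) : a ⊗ₜ[k] c ∈ tensorGrading 𝒜 𝒞 m := by
  have h1 : a ⊗ₜ[k] c ∈ Submodule.map₂ (TensorProduct.mk k A C) (𝒜 i) (𝒞 j) :=
    Submodule.apply_mem_map₂ _ ha hc
  exact Submodule.mem_iSup_of_mem i (Submodule.mem_iSup_of_mem j (Submodule.mem_iSup_of_mem h h1))

theorem tensorGrading_le {m : ℕ} {S : Submodule k (A ⊗[k] C)}
    (h : ∀ i j, i + j = m → ∀ a ∈ 𝒜 i, ∀ c ∈ 𝒞 j, a ⊗ₜ[k] c ∈ S) :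
    tensorGrading 𝒜 𝒞 m ≤ S :=
  iSup_le fun i => iSup_le fun j => iSup_le fun hij =>
    Submodule.map₂_le.mpr fun a ha c hc => h i j hij a ha c hc

theorem tensorGrading_eq_bot {N M : ℕ} (hA : ∀ i, N ≤ i → 𝒜 i = ⊥) (hC : ∀ j, M ≤ j → 𝒞 j = ⊥)
    {m : ℕ} (hm : N + M ≤ m) : tensorGrading 𝒜 𝒞 m = ⊥ := by
  refine eq_bot_iff.mpr (tensorGrading_le fun i j hij a ha c hc => ?_)
  rcases (show N ≤ i ∨ M ≤ j by omega) with h | h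
  · rw [hA i h, Submodule.mem_bot] at ha
    rw [ha, TensorProduct.zero_tmul]
    exact zero_mem _
  · rw [hC j h, Submodule.mem_bot] at hc
    rw [hc, TensorProduct.tmul_zero]
    exact zero_mem _

/-- If `A` is nearly Lefschetz and `C` carries a lowering operator with strings centered at `D`,
then `A ⊗ C` has the strong Lefschetz property. -/
theorem IsNearlyLefschetz.hasSLP_tensorGrading [CharZero k] [DirectSum.Decomposition 𝒜]
    [FiniteDimensional k A] {ℓ : A} (hℓ : ℓ ∈ 𝒜 1) (h1A : (1 : A) ∈ 𝒜 0) {c : ℕ}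
    (hA : IsNearlyLefschetz 𝒜 (LinearMap.mulLeft k ℓ) c)
    {x : C} (hx : x ∈ 𝒞 1) (h1C : (1 : C) ∈ 𝒞 0) (hxC : ∀ j, ∀ y ∈ 𝒞 j, x * y ∈ 𝒞 (j + 1))
    (hC : ∃ M, ∀ j, M ≤ j → 𝒞 j = ⊥) {G : Module.End k C} {D : ℕ}
    (hG0 : ∀ y ∈ 𝒞 0, G y = 0) (hG : ∀ j, ∀ y ∈ 𝒞 (j + 1), G y ∈ 𝒞 j)
    (hcomm : ∀ j, ∀ y ∈ 𝒞 j, x * G y - G (x * y) = (2 * (j : k) - D) • y) :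
    HasSLP (tensorGrading 𝒜 𝒞) := by
  obtain ⟨F, π, I⟩ := hA.exists_isLowering 1 (one_mul _) (by rw [one_mul, mul_one])
    (fun i x hx => hx)
  set e : A ⊗[k] C := ℓ ⊗ₜ 1 + 1 ⊗ₜ x with he
  set E : Module.End k (A ⊗[k] C) := LinearMap.mulLeft k e with hE
  -- As in a tensor product of Lie algebra representations, the mixed terms commute, and the weights
  -- `2i - c - π` and `2j - D` add up to `2m - (c + D) - P`.
  set H : Module.End k (A ⊗[k] C) :=
    TensorProduct.map F LinearMap.id + TensorProduct.map LinearMap.id G with hH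
  set P : Module.End k (A ⊗[k] C) := TensorProduct.map π LinearMap.id with hP
  have hEt : ∀ a c, E (a ⊗ₜ[k] c) = (ℓ * a) ⊗ₜ c + a ⊗ₜ (x * c) := by
    intro a c
    simp [hE, he, add_mul, Algebra.TensorProduct.tmul_mul_tmul]
  have hHt : ∀ a c, H (a ⊗ₜ[k] c) = F a ⊗ₜ c + a ⊗ₜ G c := by
    intro a c
    simp [hH]
  have hPt : ∀ a c, P (a ⊗ₜ[k] c) = π a ⊗ₜ c := by
    intro a c
    simp [hP]
  have hπL : ∀ a, π (ℓ * a) = ℓ * π a := fun a => LinearMap.congr_fun I.comm a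
  have hπF : ∀ a, π (F a) = F (π a) := fun a => LinearMap.congr_fun I.comm_lower a
  have hππ : ∀ a, π (π a) = π a := fun a => LinearMap.congr_fun I.mul_self a
  have hPE : P ∘ₗ E = E ∘ₗ P := by
    ext a c
    simp [hEt, hPt, hπL]
  have hPH : P ∘ₗ H = H ∘ₗ P := by
    ext a c
    simp [hHt, hPt, hπF]
  have hPP : P ∘ₗ P = P := by
    ext a c
    simp [hPt, hππ]
  have hEmem : ∀ m, ∀ z ∈ tensorGrading 𝒜 𝒞 m, E z ∈ tensorGrading 𝒜 𝒞 (m + 1) := by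
    intro m
    refine tensorGrading_le (S := (tensorGrading 𝒜 𝒞 (m + 1)).comap E) fun i j hij a ha c hc => ?_
    rw [Submodule.mem_comap, hEt]
    exact add_mem (tmul_mem_tensorGrading (by omega) (hA.map_mem i a ha) hc)
      (tmul_mem_tensorGrading (by omega) ha (hxC j c hc))
  have hHmem : ∀ m, ∀ z ∈ tensorGrading 𝒜 𝒞 (m + 1), H z ∈ tensorGrading 𝒜 𝒞 m := by
    intro m
    refine tensorGrading_le (S := (tensorGrading 𝒜 𝒞 m).comap H) fun i j hij a ha c hc => ?_
    rw [Submodule.mem_comap, hHt]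
    refine add_mem ?_ ?_
    · cases i with
      | zero => rw [I.lower_zero a ha, TensorProduct.zero_tmul]; exact zero_mem _
      | succ i => exact tmul_mem_tensorGrading (by omega) (I.lower_mem i a ha) hc
    · cases j with
      | zero => rw [hG0 c hc, TensorProduct.tmul_zero]; exact zero_mem _
      | succ j => exact tmul_mem_tensorGrading (by omega) ha (hG j c hc)
  have hH0 : ∀ z ∈ tensorGrading 𝒜 𝒞 0, H z = 0 := by
    refine tensorGrading_le (S := LinearMap.ker H) fun i j hij a ha c hc => ?_
    obtain rfl : i = 0 := by omega
    obtain rfl : j = 0 := by omega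
    rw [LinearMap.mem_ker, hHt, I.lower_zero a ha, hG0 c hc]
    simp
  have hPmem : ∀ m, ∀ z ∈ tensorGrading 𝒜 𝒞 m, P z ∈ tensorGrading 𝒜 𝒞 m := by
    intro m
    refine tensorGrading_le (S := (tensorGrading 𝒜 𝒞 m).comap P) fun i j hij a ha c hc => ?_
    rw [Submodule.mem_comap, hPt]
    exact tmul_mem_tensorGrading hij (I.map_mem i a ha) hc
  have hEH : ∀ m, ∀ z ∈ tensorGrading 𝒜 𝒞 m,
      E (H z) - H (E z) = (2 * (m : k) - (c + D)) • z - P z := by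
    intro m
    refine tensorGrading_le (S := LinearMap.eqLocus (E ∘ₗ H - H ∘ₗ E)
      ((2 * (m : k) - (c + D)) • LinearMap.id - P)) fun i j hij a ha y hy => ?_
    rw [LinearMap.mem_eqLocus]
    have h1 := I.commutator i a ha
    rw [LinearMap.mulLeft_apply, LinearMap.mulLeft_apply, Module.End.one_apply,
      sub_eq_iff_eq_add] at h1
    have h2 := hcomm j y hy
    rw [sub_eq_iff_eq_add] at h2
    subst hij
    simp only [LinearMap.sub_apply, LinearMap.comp_apply, hEt, hHt, hPt, map_add, h1, h2,
      LinearMap.smul_apply, LinearMap.id_apply, TensorProduct.add_tmul, TensorProduct.tmul_add,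
      TensorProduct.sub_tmul, ← TensorProduct.smul_tmul', TensorProduct.tmul_smul]
    push_cast
    module
  obtain ⟨M, hM⟩ := hC
  have hfull := pow_raise_injOn_or_surjOn (U := tensorGrading 𝒜 𝒞) (E := E) (H := H) (P := P)
    (c := c + D) hPE hPH hPP hEmem hHmem hH0 hPmem (fun m z hz => by rw [hEH m z hz, Nat.cast_add])
    ⟨c + 2 + M, fun m hm => tensorGrading_eq_bot (fun i hi => hA.eq_bot i hi) hM hm⟩
  have hpow : ∀ t : ℕ, (fun z => e ^ t * z) = fun z => (E ^ t) z := fun t => by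
    rw [hE, LinearMap.pow_mulLeft]
    rfl
  have he1 : ℓ ⊗ₜ[k] (1 : C) + (1 : A) ⊗ₜ[k] x ∈ tensorGrading 𝒜 𝒞 1 :=
    add_mem (tmul_mem_tensorGrading (add_zero 1) hℓ h1C)
      (tmul_mem_tensorGrading (zero_add 1) h1A hx)
  rw [← he] at he1
  refine ⟨e, he1, fun t m => ?_⟩
  rw [hpow]
  exact hfull t m

end TensorGrading

/-! ### The graded isomorphism with the monomial complete intersection -/

section Isomorphism

variable (k : Type*) [Field k] {n : ℕ} (d : Fin n → ℕ)

/-- The algebra map `k[x]/(x^(d_i)) → k[x_1, …, x_n]/(x_1^(d_1), …, x_n^(d_n))`, `x ↦ x_i`. -/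
noncomputable def truncToCI (i : Fin n) : Trunc k (d i) →ₐ[k] MonomialCI k d :=
  AdjoinRoot.liftAlgHom _ (Algebra.ofId k _) (ciX k d i) (by
    rw [Polynomial.eval₂_X_pow]; exact ciX_pow k i)

theorem truncToCI_root (i : Fin n) :
    truncToCI k d i (AdjoinRoot.root ((Polynomial.X : Polynomial k) ^ d i)) = ciX k d i := by
  simp [truncToCI]

theorem root_pow_self (m : ℕ) : AdjoinRoot.root ((Polynomial.X : Polynomial k) ^ m) ^ m = 0 := by
  have := AdjoinRoot.eval₂_root ((Polynomial.X : Polynomial k) ^ m)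
  rwa [Polynomial.eval₂_X_pow] at this

/-- The algebra map `⨂ k[x_i]/(x_i^(d_i)) → k[x_1, …, x_n]/(x_1^(d_1), …, x_n^(d_n))`. -/
noncomputable def piTruncToCI : (⨂[k] i, Trunc k (d i)) →ₐ[k] MonomialCI k d :=
  PiTensorProduct.liftAlgHom
    ((MultilinearMap.mkPiAlgebra k (Fin n) (MonomialCI k d)).compLinearMap
      fun i => (truncToCI k d i).toLinearMap)
    (by simp) (by intro x y; simp [Finset.prod_mul_distrib])

theorem piTruncToCI_tprod (x : ∀ i, Trunc k (d i)) :
    piTruncToCI k d (PiTensorProduct.tprod k x) = ∏ i, truncToCI k d i (x i) := by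
  change PiTensorProduct.lift _ (PiTensorProduct.tprod k x) = _
  rw [PiTensorProduct.lift.tprod]
  rfl

theorem piTruncToCI_single (i : Fin n) (a : Trunc k (d i)) :
    piTruncToCI k d (PiTensorProduct.singleAlgHom i a) = truncToCI k d i a := by
  rw [PiTensorProduct.singleAlgHom_apply, piTruncToCI_tprod, Finset.prod_eq_single i]
  · simp
  · intro j _ hji
    simp [Pi.mulSingle_eq_of_ne hji]
  · simp

/-- The inverse of `piTruncToCI`. -/
noncomputable def ciToPiTrunc : MonomialCI k d →ₐ[k] (⨂[k] i, Trunc k (d i)) :=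
  Ideal.Quotient.liftₐ (powIdeal k d)
    (MvPolynomial.aeval fun i => PiTensorProduct.singleAlgHom (R := k)
      (A := fun i => Trunc k (d i)) i (AdjoinRoot.root ((Polynomial.X : Polynomial k) ^ d i)))
    (by
      intro f hf
      rw [← RingHom.mem_ker]
      revert f
      change powIdeal k d ≤ _
      rw [Ideal.span_le]
      rintro _ ⟨i, rfl⟩
      rw [SetLike.mem_coe, RingHom.mem_ker]
      change MvPolynomial.aeval _ (MvPolynomial.X i ^ d i) = 0
      rw [map_pow, MvPolynomial.aeval_X, ← map_pow, root_pow_self, map_zero])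

theorem ciToPiTrunc_ciX (i : Fin n) :
    ciToPiTrunc k d (ciX k d i) = PiTensorProduct.singleAlgHom (R := k)
      (A := fun i => Trunc k (d i)) i (AdjoinRoot.root ((Polynomial.X : Polynomial k) ^ d i)) := by
  change MvPolynomial.aeval _ (MvPolynomial.X i) = _
  rw [MvPolynomial.aeval_X]

/-- The algebra isomorphism between the tensor product of the `k[x_i]/(x_i^(d_i))` and the
monomial complete intersection. -/
noncomputable def piTruncEquiv : (⨂[k] i, Trunc k (d i)) ≃ₐ[k] MonomialCI k d :=
  AlgEquiv.ofAlgHom (piTruncToCI k d) (ciToPiTrunc k d)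
    (by
      refine Ideal.Quotient.algHom_ext _ (MvPolynomial.algHom_ext fun i => ?_)
      change piTruncToCI k d (ciToPiTrunc k d (ciX k d i)) = ciX k d i
      rw [ciToPiTrunc_ciX, piTruncToCI_single, truncToCI_root])
    (by
      refine PiTensorProduct.algHom_ext fun i => AdjoinRoot.algHom_ext ?_
      change ciToPiTrunc k d (piTruncToCI k d (PiTensorProduct.singleAlgHom i _)) =
        PiTensorProduct.singleAlgHom i _
      rw [piTruncToCI_single, truncToCI_root, ciToPiTrunc_ciX])

theorem piTruncEquiv_tprod (x : ∀ i, Trunc k (d i)) :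
    piTruncEquiv k d (PiTensorProduct.tprod k x) = ∏ i, truncToCI k d i (x i) :=
  piTruncToCI_tprod k d x

theorem map_piTensorGrading (m : ℕ) :
    (piTensorGrading (fun i => truncGrading k (d i)) m).map (piTruncEquiv k d).toLinearMap =
      monomialCIGrading k d m := by
  apply le_antisymm
  · rw [piTensorGrading, Submodule.map_span, Submodule.span_le]
    rintro _ ⟨_, ⟨e, x, he, hx, rfl⟩, rfl⟩
    have hx' : ∀ i, ∃ c : k, c • ciX k d i ^ e i = truncToCI k d i (x i) := by
      intro i
      obtain ⟨c, hc⟩ := Submodule.mem_span_singleton.mp (hx i)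
      exact ⟨c, by rw [← hc, map_smul, map_pow, truncToCI_root]⟩
    choose c hc using hx'
    rw [AlgEquiv.toLinearMap_apply, piTruncEquiv_tprod, SetLike.mem_coe, mem_monomialCIGrading]
    refine ⟨∏ i, c i • MvPolynomial.X i ^ e i, ?_, ?_⟩
    · rw [← he]
      refine MvPolynomial.IsHomogeneous.prod _ _ _ fun i _ => ?_
      rw [MvPolynomial.smul_eq_C_mul]
      exact MvPolynomial.isHomogeneous_C_mul_X_pow _ _ _
    · rw [map_prod]
      refine Finset.prod_congr rfl fun i _ => ?_
      rw [map_smul, map_pow, ← hc]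
      rfl
  · intro y hy
    obtain ⟨f, hf, rfl⟩ := (mem_monomialCIGrading k).mp hy
    rw [f.as_sum, map_sum]
    refine Submodule.sum_mem _ fun e he => ?_
    have hdeg : ∑ i, e i = m := by
      have := hf (MvPolynomial.mem_support_iff.mp he)
      simpa [Finsupp.weight_apply, Finsupp.sum_fintype] using this
    refine ⟨f.coeff e • PiTensorProduct.tprod k fun i =>
      AdjoinRoot.root ((Polynomial.X : Polynomial k) ^ d i) ^ e i, ?_, ?_⟩
    · exact Submodule.smul_mem _ _ (Submodule.subset_span ⟨e, _, hdeg,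
        fun i => Submodule.subset_span rfl, rfl⟩)
    · rw [AlgEquiv.toLinearMap_apply, map_smul, piTruncEquiv_tprod, MvPolynomial.monomial_eq,
        ← MvPolynomial.smul_eq_C_mul, map_smul, Finsupp.prod_fintype _ _ (by simp), map_prod]
      congr 1
      refine Finset.prod_congr rfl fun i _ => ?_
      rw [map_pow, map_pow, truncToCI_root]
      rfl

variable {k}

theorem map_tensorGrading {A C C' : Type*} [CommRing A] [Algebra k A] [CommRing C] [Algebra k C]
    [CommRing C'] [Algebra k C'] (𝒜 : ℕ → Submodule k A) {𝒞 : ℕ → Submodule k C}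
    {𝒞' : ℕ → Submodule k C'} (e : C ≃ₐ[k] C') (he : ∀ m, (𝒞 m).map e.toLinearMap = 𝒞' m)
    (m : ℕ) :
    (tensorGrading 𝒜 𝒞 m).map
        (Algebra.TensorProduct.congr (AlgEquiv.refl (A₁ := A) (R := k)) e).toLinearMap =
      tensorGrading 𝒜 𝒞' m := by
  apply le_antisymm
  · rw [Submodule.map_le_iff_le_comap]
    refine tensorGrading_le fun i j hij a ha c hc => ?_
    rw [Submodule.mem_comap]
    refine tmul_mem_tensorGrading (A := A) hij ha ?_
    rw [← he]
    exact ⟨c, hc, rfl⟩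
  · refine tensorGrading_le fun i j hij a ha c hc => ?_
    rw [← he] at hc
    obtain ⟨c', hc', rfl⟩ := hc
    exact ⟨a ⊗ₜ c', tmul_mem_tensorGrading hij ha hc', rfl⟩

end Isomorphism

/-! ### Kernels and cokernels of powers of `ℓ + cx` -/

section Coefficients

variable {k B T : Type*} [Field k] [CommRing B] [Algebra k B] [CommRing T] [Algebra k T]

/-- The functionals `γ w`, `w < d`, extract the coefficient of `x ^ w` in an algebra with
`x ^ d = 0`. -/
structure IsCoeff (x : T) (d : ℕ) (γ : ℕ → T →ₗ[k] k) : Prop where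
  zero_mul : ∀ y, γ 0 (x * y) = 0
  succ_mul : ∀ w, w + 1 < d → ∀ y, γ (w + 1) (x * y) = γ w y
  zero_one : γ 0 1 = 1
  succ_one : ∀ w, w + 1 < d → γ (w + 1) 1 = 0
  pow_eq : x ^ d = 0

theorem IsCoeff.pow {x : T} {d : ℕ} {γ : ℕ → T →ₗ[k] k} (hγ : IsCoeff x d γ) (u : ℕ) {w : ℕ}
    (hw : w < d) : γ w (x ^ u) = if w = u then 1 else 0 := by
  induction u generalizing w with
  | zero =>
    cases w with
    | zero => simp [hγ.zero_one]
    | succ w => simp [hγ.succ_one w hw]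
  | succ u ih =>
    rw [pow_succ']
    cases w with
    | zero => simp [hγ.zero_mul]
    | succ w => simp [hγ.succ_mul w hw, ih (Nat.lt_of_succ_lt hw)]

/-- The coefficient map `B ⊗ T → B` induced by a functional on `T`. -/
noncomputable def tensorCoeff (B : Type*) [CommRing B] [Algebra k B] (f : T →ₗ[k] k) :
    B ⊗[k] T →ₗ[k] B :=
  (TensorProduct.rid k B).toLinearMap ∘ₗ TensorProduct.map LinearMap.id f

@[simp]
theorem tensorCoeff_tmul (f : T →ₗ[k] k) (b : B) (y : T) :
    tensorCoeff B f (b ⊗ₜ y) = f y • b := by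
  simp [tensorCoeff]

/-- The general linear form `ℓ + c x` on `B ⊗ T`. -/
noncomputable def mixedForm (ℓ : B) (c : k) (x : T) : B ⊗[k] T := ℓ ⊗ₜ 1 + c • (1 ⊗ₜ x)

theorem mixedForm_mul_tmul (ℓ : B) (c : k) (x : T) (b : B) (y : T) :
    mixedForm ℓ c x * b ⊗ₜ y = (ℓ * b) ⊗ₜ y + c • (b ⊗ₜ (x * y)) := by
  simp [mixedForm, add_mul, Algebra.TensorProduct.tmul_mul_tmul]

variable {x : T} {d : ℕ} {γ : ℕ → T →ₗ[k] k}

theorem IsCoeff.tensorCoeff_zero_mul (hγ : IsCoeff x d γ) (ℓ : B) (c : k) (z : B ⊗[k] T) :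
    tensorCoeff B (γ 0) (mixedForm ℓ c x * z) = ℓ * tensorCoeff B (γ 0) z := by
  induction z with
  | zero => simp
  | add z z' h h' => rw [mul_add, map_add, map_add, h, h', mul_add]
  | tmul b y => rw [mixedForm_mul_tmul]; simp [hγ.zero_mul]

theorem IsCoeff.tensorCoeff_succ_mul (hγ : IsCoeff x d γ) (ℓ : B) (c : k) {w : ℕ} (hw : w + 1 < d)
    (z : B ⊗[k] T) :
    tensorCoeff B (γ (w + 1)) (mixedForm ℓ c x * z) =
      ℓ * tensorCoeff B (γ (w + 1)) z + c • tensorCoeff B (γ w) z := by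
  induction z with
  | zero => simp
  | add z z' h h' => simp only [mul_add, map_add, h, h', smul_add]; abel
  | tmul b y => rw [mixedForm_mul_tmul]; simp [hγ.succ_mul w hw]

theorem IsCoeff.tensorCoeff_zero_pow_mul (hγ : IsCoeff x d γ) (ℓ : B) (c : k) (t : ℕ)
    (z : B ⊗[k] T) :
    tensorCoeff B (γ 0) (mixedForm ℓ c x ^ t * z) = ℓ ^ t * tensorCoeff B (γ 0) z := by
  induction t with
  | zero => simp
  | succ t ih => rw [pow_succ', mul_assoc, hγ.tensorCoeff_zero_mul, ih, pow_succ', mul_assoc]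

variable {ℬ : ℕ → Submodule k B} {𝒯 : ℕ → Submodule k T}

/-- A string killed early produces elements of `B ⊗ T` killed by a power of the linear form. -/
theorem IsCoeff.exists_pow_mul_eq_zero (hγ : IsCoeff x d γ) (hx : ∀ j, x ^ j ∈ 𝒯 j)
    {ℓ : B} (hℓ : ∀ i, ∀ b ∈ ℬ i, ℓ * b ∈ ℬ (i + 1)) (c : k) {a p r g t : ℕ} {v : B}
    (hv : v ∈ ℬ a) (hp : ℓ ^ p * v = 0) (hp' : ℓ ^ (p - 1) * v ≠ 0) (hr : 1 ≤ r) (hrp : r ≤ p)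
    (hrg : r ≤ g + 1) (hgd : g + 1 ≤ d) (hcount : p + d < r + g + t + 1) :
    ∃ z ∈ tensorGrading ℬ 𝒯 (a + g), z ≠ 0 ∧ mixedForm ℓ c x ^ t * z = 0 := by
  classical
  set ζ : ℕ → ℕ → B ⊗[k] T := fun e w => (ℓ ^ e * v) ⊗ₜ (x ^ w) with hζ
  have hζmul : ∀ e w, mixedForm ℓ c x * ζ e w = ζ (e + 1) w + c • ζ e (w + 1) := by
    intro e w
    simp only [hζ, mixedForm_mul_tmul, pow_succ', mul_assoc]
  have hζp : ∀ e w, p ≤ e → ζ e w = 0 := by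
    intro e w he
    obtain ⟨f, rfl⟩ := Nat.exists_eq_add_of_le' he
    simp [hζ, pow_add, mul_assoc, hp]
  have hζd : ∀ e w, d ≤ w → ζ e w = 0 := by
    intro e w hw
    obtain ⟨f, rfl⟩ := Nat.exists_eq_add_of_le' hw
    simp [hζ, pow_add, hγ.pow_eq]
  set S : ℕ → Submodule k (B ⊗[k] T) := fun N =>
    Submodule.span k {z | ∃ e w, e + w = N ∧ ζ e w = z} with hS
  have hζS : ∀ e w, ζ e w ∈ S (e + w) := fun e w => Submodule.subset_span ⟨e, w, rfl, rfl⟩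
  have hSmul : ∀ N, ∀ z ∈ S N, mixedForm ℓ c x * z ∈ S (N + 1) := by
    intro N
    change S N ≤ (S (N + 1)).comap (LinearMap.mulLeft k (mixedForm ℓ c x))
    refine Submodule.span_le.mpr ?_
    rintro _ ⟨e, w, rfl, rfl⟩
    rw [SetLike.mem_coe, Submodule.mem_comap, LinearMap.mulLeft_apply, hζmul]
    refine add_mem ?_ (Submodule.smul_mem _ _ (hζS e (w + 1)))
    rw [add_right_comm]
    exact hζS (e + 1) w
  have hSpow : ∀ s N, ∀ z ∈ S N, mixedForm ℓ c x ^ s * z ∈ S (N + s) := by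
    intro s N z hz
    induction s with
    | zero => simpa using hz
    | succ s ih => rw [pow_succ', mul_assoc]; exact hSmul _ _ ih
  have hSfin : ∀ N, S N ≤ Submodule.span k
      ((((Finset.Ico (N + 1 - d) p).image fun e => ζ e (N - e)) : Finset (B ⊗[k] T)) :
        Set (B ⊗[k] T)) := by
    intro N
    refine Submodule.span_le.mpr ?_
    rintro _ ⟨e, w, rfl, rfl⟩
    by_cases he : p ≤ e
    · rw [hζp e w he]; exact zero_mem _
    by_cases hw : d ≤ w
    · rw [hζd e w hw]; exact zero_mem _
    refine Submodule.subset_span (Finset.mem_coe.mpr (Finset.mem_image.mpr ⟨e, ?_, ?_⟩))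
    · rw [Finset.mem_Ico]; omega
    · rw [Nat.add_sub_cancel_left]
  set R := Submodule.span k
    ((((Finset.Ico (g + t + 1 - d) p).image fun e => ζ e (g + t - e)) : Finset (B ⊗[k] T)) :
      Set (B ⊗[k] T)) with hR
  -- In total degree `g + t` only the `ℓ^e v ⊗ x^w` with `e < p` and `w < d` survive; by `hcount`
  -- there are fewer of them than the `r` unknowns.
  have hRdim : Module.finrank k R < r := by
    refine lt_of_le_of_lt ((finrank_span_finset_le_card _).trans Finset.card_image_le) ?_
    rw [Nat.card_Ico]
    omega
  set M : (Fin r → k) →ₗ[k] B ⊗[k] T :=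
    Fintype.linearCombination k fun q : Fin r => ζ q (g - q) with hM
  have hMx : ∀ f, M f = ∑ q : Fin r, f q • ζ q (g - q) := fun f =>
    Fintype.linearCombination_apply _ _ _
  have hMR : ∀ f, (LinearMap.mulLeft k (mixedForm ℓ c x ^ t) ∘ₗ M) f ∈ R := by
    intro f
    rw [LinearMap.comp_apply, LinearMap.mulLeft_apply]
    refine hSfin (g + t) (hSpow t g _ ?_)
    rw [hMx]
    refine Submodule.sum_mem _ fun q _ => Submodule.smul_mem _ _ ?_
    have := hζS q (g - q)
    rwa [Nat.add_sub_cancel' (by omega)] at this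
  have hker := LinearMap.ker_ne_bot_of_finrank_lt (f := LinearMap.codRestrict R _ hMR)
    (by rwa [Module.finrank_fin_fun])
  obtain ⟨f, hf, hf0⟩ := Submodule.exists_mem_ne_zero_of_ne_bot hker
  refine ⟨M f, ?_, ?_, congrArg Subtype.val (LinearMap.mem_ker.mp hf)⟩
  · rw [hMx]
    refine Submodule.sum_mem _ fun q _ => Submodule.smul_mem _ _ ?_
    refine tmul_mem_tensorGrading (i := a + q) (by omega) ?_ (hx _)
    have : ∀ e : ℕ, ℓ ^ e * v ∈ ℬ (a + e) := by
      intro e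
      induction e with
      | zero => simpa using hv
      | succ e ih => rw [pow_succ', mul_assoc]; exact hℓ _ _ ih
    exact this q
  -- The coefficient of `x ^ (g - q)` in `M f` is `f q • ℓ ^ q v`, and `ℓ ^ q v ≠ 0` because `q ≤ p
  -- - 1`.
  · intro hMf
    refine hf0 (funext fun q => ?_)
    have h := congrArg (tensorCoeff B (γ (g - q))) hMf
    rw [hMx, map_sum, map_zero, Finset.sum_eq_single q] at h
    · rw [map_smul, tensorCoeff_tmul, hγ.pow _ (by omega), if_pos rfl, one_smul,
        smul_eq_zero] at h
      refine h.resolve_right fun h0 => hp' ?_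
      rw [show p - 1 = (p - 1 - q) + q by omega, pow_add, mul_assoc, h0, mul_zero]
    · intro q' _ hne
      have : (g - q : ℕ) ≠ g - q' := by
        intro h
        exact hne (Fin.ext (by omega))
      rw [map_smul, tensorCoeff_tmul, hγ.pow _ (by omega), if_neg this, zero_smul, smul_zero]
    · simp

/-- A functional killed early by `ℓ` produces elements of `B ⊗ T` outside the image of a power of
the linear form. -/
theorem IsCoeff.exists_forall_pow_mul_ne [DirectSum.Decomposition ℬ] (hγ : IsCoeff x d γ)
    (hx : ∀ j, x ^ j ∈ 𝒯 j)
    {ℓ : B} (hℓ : ∀ i, ∀ b ∈ ℬ i, ℓ * b ∈ ℬ (i + 1)) (c : k) {b p r g t : ℕ} {φ : B →ₗ[k] k}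
    (hφ : ∀ i, i ≠ b → ∀ y ∈ ℬ i, φ y = 0) (hp : ∀ y, φ (ℓ ^ p * y) = 0)
    (hp' : ∃ y, φ (ℓ ^ (p - 1) * y) ≠ 0) (hr : 1 ≤ r) (hrp : r ≤ p) (hgd : g + r ≤ d)
    (hcount : p + g < r + t) :
    ∃ y ∈ tensorGrading ℬ 𝒯 (b + g), ∀ z, mixedForm ℓ c x ^ t * z ≠ y := by
  by_contra! hsurj
  have hpow : ∀ (e i : ℕ) (y : B), y ∈ ℬ i → ℓ ^ e * y ∈ ℬ (i + e) := by
    intro e i y hy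
    induction e with
    | zero => simpa using hy
    | succ e ih => rw [pow_succ', mul_assoc]; exact hℓ _ _ ih
  have hpe : ∀ e, p ≤ e → ∀ y, φ (ℓ ^ e * y) = 0 := by
    intro e he y
    obtain ⟨f, rfl⟩ := Nat.exists_eq_add_of_le he
    rw [pow_add, mul_assoc]
    exact hp _
  obtain ⟨a, y₀, hy₀, hne⟩ : ∃ a, ∃ y ∈ ℬ a, φ (ℓ ^ (p - 1) * y) ≠ 0 := by
    refine exists_homogeneous_apply_ne_zero ℬ (f := φ ∘ₗ LinearMap.mulLeft k (ℓ ^ (p - 1))) ?_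
    obtain ⟨y, hy⟩ := hp'
    exact fun h => hy (LinearMap.congr_fun h y)
  have hab : a + (p - 1) = b := by
    by_contra h
    exact hne (hφ _ h _ (hpow _ _ _ hy₀))
  have hz : ∀ q : Fin r, ∃ z, mixedForm ℓ c x ^ t * z = (ℓ ^ (p - 1 - q) * y₀) ⊗ₜ (x ^ (g + q)) :=
    fun q => hsurj _ (tmul_mem_tensorGrading (i := a + (p - 1 - q)) (j := g + q)
      (m := b + g) (by omega)
      (hpow _ _ _ hy₀) (hx _))
  choose z hz using hz
  set Z : (Fin r → k) →ₗ[k] B ⊗[k] T := Fintype.linearCombination k z with hZ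
  -- The conditions `φ (ℓ^e · coeff_w) = 0` are imposed on the line `e + g = w + t`. Only `t - g ≤ e
  -- < p` matters, and by `hcount` this is fewer than `r` conditions.
  set N : (Fin r → k) →ₗ[k] (Fin (p - (t - g)) → k) := LinearMap.pi fun j =>
    φ ∘ₗ LinearMap.mulLeft k (ℓ ^ (t - g + j)) ∘ₗ tensorCoeff B (γ (t - g + j + g - t)) ∘ₗ Z with hN
  have hker := LinearMap.ker_ne_bot_of_finrank_lt (f := N)
    (by rw [Module.finrank_fin_fun, Module.finrank_fin_fun]; omega)
  obtain ⟨f, hf, hf0⟩ := Submodule.exists_mem_ne_zero_of_ne_bot hker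
  have hbase : ∀ e w, w < d → e + g = w + t → φ (ℓ ^ e * tensorCoeff B (γ w) (Z f)) = 0 := by
    intro e w hw hew
    by_cases he : p ≤ e
    · exact hpe e he _
    · have h := congrFun (LinearMap.mem_ker.mp hf) ⟨e - (t - g), by omega⟩
      simp only [hN, LinearMap.pi_apply, LinearMap.comp_apply, LinearMap.mulLeft_apply] at h
      rwa [show t - g + (e - (t - g)) = e by omega, show e + g - t = w by omega] at h
  -- Each multiplication by the form carries the vanishing to the next line `e + g + s = w + t`.
  -- After `t` steps it reaches `e + g = w`, where the pairing reads off `f q` times a nonzero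
  -- scalar.
  have hstep : ∀ s e w, w < d → e + g + s = w + t →
      φ (ℓ ^ e * tensorCoeff B (γ w) (mixedForm ℓ c x ^ s * Z f)) = 0 := by
    intro s
    induction s with
    | zero => intro e w hw hew; simpa using hbase e w hw hew
    | succ s ih =>
      intro e w hw hew
      rw [pow_succ', mul_assoc]
      cases w with
      | zero =>
        rw [hγ.tensorCoeff_zero_mul, ← mul_assoc, ← pow_succ]
        exact ih (e + 1) 0 hw (by omega)
      | succ w =>
        rw [hγ.tensorCoeff_succ_mul _ _ hw, mul_add, ← mul_assoc, ← pow_succ, map_add,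
          mul_smul_comm, map_smul, ih (e + 1) (w + 1) hw (by omega),
          ih e w (by omega) (by omega), smul_zero, add_zero]
  refine hf0 (funext fun q => ?_)
  have h := hstep t q (g + q) (by omega) (by omega)
  have hZf : mixedForm ℓ c x ^ t * Z f =
      ∑ q : Fin r, f q • ((ℓ ^ (p - 1 - q) * y₀) ⊗ₜ[k] (x ^ (g + q))) := by
    rw [hZ, Fintype.linearCombination_apply, Finset.mul_sum]
    exact Finset.sum_congr rfl fun q _ => by rw [mul_smul_comm, hz]
  rw [hZf, map_sum, Finset.sum_eq_single q] at h
  · rw [map_smul, tensorCoeff_tmul, hγ.pow _ (by omega), if_pos rfl, one_smul, mul_smul_comm,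
      ← mul_assoc, ← pow_add, show (q : ℕ) + (p - 1 - q) = p - 1 by omega, map_smul,
      smul_eq_mul] at h
    exact (mul_eq_zero.mp h).resolve_right hne
  · intro q' _ hne'
    have : (g + q : ℕ) ≠ g + q' := fun h => hne' (Fin.ext (by omega))
    rw [map_smul, tensorCoeff_tmul, hγ.pow _ (by omega), if_neg this, zero_smul, smul_zero]
  · simp

theorem exists_eq_mixedForm (h0 : ℬ 0 = 1) {x : T} (h𝒯0 : 𝒯 0 ≤ Submodule.span k {1})
    (h𝒯1 : 𝒯 1 ≤ Submodule.span k {x}) {z : B ⊗[k] T} (hz : z ∈ tensorGrading ℬ 𝒯 1) :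
    ∃ ℓ ∈ ℬ 1, ∃ c : k, z = mixedForm ℓ c x := by
  set S : Submodule k (B ⊗[k] T) :=
    (ℬ 1).map ((TensorProduct.mk k B T).flip 1) ⊔ Submodule.span k {1 ⊗ₜ x} with hS
  have hle : tensorGrading ℬ 𝒯 1 ≤ S := by
    refine tensorGrading_le fun i j hij b hb y hy => ?_
    rcases (show (i = 1 ∧ j = 0) ∨ (i = 0 ∧ j = 1) by omega) with ⟨rfl, rfl⟩ | ⟨rfl, rfl⟩
    · obtain ⟨c, rfl⟩ := Submodule.mem_span_singleton.mp (h𝒯0 hy)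
      rw [TensorProduct.tmul_smul, TensorProduct.smul_tmul']
      exact Submodule.mem_sup_left ⟨c • b, Submodule.smul_mem _ _ hb, rfl⟩
    · obtain ⟨c, rfl⟩ := Submodule.mem_span_singleton.mp (h𝒯1 hy)
      rw [h0, Submodule.mem_one] at hb
      obtain ⟨c', rfl⟩ := hb
      rw [Algebra.algebraMap_eq_smul_one, TensorProduct.tmul_smul, ← TensorProduct.smul_tmul',
        smul_smul]
      exact Submodule.mem_sup_right (Submodule.smul_mem _ _ (Submodule.mem_span_singleton_self _))
  obtain ⟨_, ⟨ℓ, hℓ, rfl⟩, y, hy, rfl⟩ := Submodule.mem_sup.mp (hle hz)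
  obtain ⟨c, rfl⟩ := Submodule.mem_span_singleton.mp hy
  exact ⟨ℓ, hℓ, c, rfl⟩

/-- For `d = 1` the grading of `T` reduces to the constants and `x = 0`; the form is `ℓ ⊗ 1`, and
the constant coefficient inverts `b ↦ b ⊗ 1`. -/
theorem hasSLP_of_hasSLP_tensorGrading (h0 : ℬ 0 = 1) {x : T} {γ : ℕ → T →ₗ[k] k}
    (hγ : IsCoeff x 1 γ) (h1 : (1 : T) ∈ 𝒯 0) (h𝒯0 : 𝒯 0 ≤ Submodule.span k {1})
    (h𝒯1 : 𝒯 1 ≤ Submodule.span k {x}) (h𝒯 : ∀ j, 1 ≤ j → 𝒯 j = ⊥)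
    (hSLP : HasSLP (tensorGrading ℬ 𝒯)) : HasSLP ℬ := by
  obtain ⟨e, he, hSLP⟩ := hSLP
  obtain ⟨ℓ, hℓ, c, rfl⟩ := exists_eq_mixedForm h0 h𝒯0 h𝒯1 he
  have hx0 : x = 0 := by simpa using hγ.pow_eq
  have hform : mixedForm ℓ c x = ℓ ⊗ₜ 1 := by simp [mixedForm, hx0]
  have hcoeff : ∀ b : B, tensorCoeff B (γ 0) (b ⊗ₜ[k] (1 : T)) = b := by
    intro b
    rw [tensorCoeff_tmul, hγ.zero_one, one_smul]
  refine ⟨ℓ, hℓ, fun t i => (hSLP t i).imp (fun hinj => ?_) fun hsurj => ?_⟩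
  · intro b hb b' hb' hbb
    have := hinj (tmul_mem_tensorGrading (add_zero i) hb h1)
      (tmul_mem_tensorGrading (add_zero i) hb' h1) (by
        simp only [hform, Algebra.TensorProduct.tmul_pow, one_pow,
          Algebra.TensorProduct.tmul_mul_tmul, one_mul] at hbb ⊢
        rw [hbb])
    rw [← hcoeff b, this, hcoeff]
  · intro y hy
    obtain ⟨z, hz, hzy⟩ := hsurj (tmul_mem_tensorGrading (add_zero (i + t)) hy h1)
    refine ⟨tensorCoeff B (γ 0) z, ?_, ?_⟩
    · have : tensorGrading ℬ 𝒯 i ≤ (ℬ i).comap (tensorCoeff B (γ 0)) := by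
        refine tensorGrading_le fun i' j hij b hb y hy => ?_
        rw [Submodule.mem_comap, tensorCoeff_tmul]
        obtain rfl | hj := Nat.eq_zero_or_pos j
        · obtain rfl : i' = i := hij
          exact Submodule.smul_mem _ _ hb
        · rw [h𝒯 j hj, Submodule.mem_bot] at hy
          rw [hy, map_zero, zero_smul]
          exact zero_mem _
      exact this hz
    · have h := congrArg (tensorCoeff B (γ 0)) hzy
      simp only [hγ.tensorCoeff_zero_pow_mul] at h
      rw [hcoeff] at h
      exact h

end Coefficients

/-! ### Hilbert functions under the SLP, and their center -/

section HilbertFunction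

variable {k B : Type*} [Field k] [CommRing B] [Algebra k B] {ℬ : ℕ → Submodule k B}

theorem hilb_natCast (i : ℕ) : hilb ℬ (i : ℤ) = Module.finrank k (ℬ i) := by
  simp [hilb]

theorem hilb_of_neg {i : ℤ} (hi : i < 0) : hilb ℬ i = 0 := by
  simp [hilb, hi.not_ge]

theorem pow_mul_mem [GradedAlgebra ℬ] {ℓ : B} (hℓ : ℓ ∈ ℬ 1) (t : ℕ) {i : ℕ} {b : B}
    (hb : b ∈ ℬ i) : ℓ ^ t * b ∈ ℬ (i + t) := by
  have h := SetLike.mul_mem_graded (SetLike.pow_mem_graded t hℓ) hb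
  rwa [smul_eq_mul, mul_one, add_comm] at h

theorem IsStandardGraded.finiteDimensional [GradedAlgebra ℬ] (hB : IsStandardGraded ℬ)
    (hart : IsArtinianRing B) : FiniteDimensional k B := by
  have := hB.finite_degree_one
  obtain ⟨s, hs⟩ : (ℬ 1).FG := Module.Finite.iff_fg.mp this
  have : Algebra.FiniteType k B := ⟨⟨s, by
    rw [eq_top_iff, ← hB.adjoin_degree_one, ← hs]
    exact Algebra.adjoin_le (Algebra.span_le_adjoin k _)⟩⟩
  exact Module.finite_of_isArtinianRing k B

theorem exists_forall_eq_bot [GradedAlgebra ℬ] [FiniteDimensional k B] :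
    ∃ N, ∀ i, N ≤ i → ℬ i = ⊥ := by
  have hfin := WellFoundedGT.finite_ne_bot_of_iSupIndep
    (DirectSum.Decomposition.isInternal ℬ).submodule_iSupIndep
  obtain ⟨N, hN⟩ := hfin.bddAbove
  refine ⟨N + 1, fun i hi => ?_⟩
  by_contra h
  exact absurd (hN h) (by omega)

/-- Multiplication by `ℓ ^ t` as a linear map between graded pieces. -/
noncomputable def gradedMul [GradedAlgebra ℬ] {ℓ : B} (hℓ : ℓ ∈ ℬ 1) (t i : ℕ) :
    ℬ i →ₗ[k] ℬ (i + t) :=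
  (LinearMap.mulLeft k (ℓ ^ t)).restrict fun _ hb => pow_mul_mem hℓ t hb

theorem gradedMul_apply [GradedAlgebra ℬ] {ℓ : B} (hℓ : ℓ ∈ ℬ 1) (t i : ℕ) (b : ℬ i) :
    (gradedMul hℓ t i b : B) = ℓ ^ t * b :=
  rfl

theorem injective_gradedMul_iff [GradedAlgebra ℬ] {ℓ : B} (hℓ : ℓ ∈ ℬ 1) (t i : ℕ) :
    Function.Injective (gradedMul hℓ t i) ↔ Set.InjOn (fun a : B => ℓ ^ t * a) (ℬ i) := by
  rw [Set.injOn_iff_injective, ← Subtype.val_injective.of_comp_iff]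
  rfl

theorem surjective_gradedMul_iff [GradedAlgebra ℬ] {ℓ : B} (hℓ : ℓ ∈ ℬ 1) (t i : ℕ) :
    Function.Surjective (gradedMul hℓ t i) ↔
      Set.SurjOn (fun a : B => ℓ ^ t * a) (ℬ i) (ℬ (i + t)) := by
  constructor
  · intro h y hy
    obtain ⟨b, hb⟩ := h ⟨y, hy⟩
    exact ⟨b, b.2, congrArg Subtype.val hb⟩
  · rintro h ⟨y, hy⟩
    obtain ⟨b, hb, hby⟩ := h hy
    exact ⟨⟨b, hb⟩, Subtype.ext hby⟩

theorem injective_gradedMul_of_le [GradedAlgebra ℬ] [FiniteDimensional k B] {ℓ : B}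
    (hℓ : ℓ ∈ ℬ 1)
    (hSLP : ∀ t i : ℕ, Set.InjOn (fun a : B => ℓ ^ t * a) (ℬ i) ∨
      Set.SurjOn (fun a : B => ℓ ^ t * a) (ℬ i) (ℬ (i + t)))
    {t i : ℕ}
    (h : Module.finrank k (ℬ i) ≤ Module.finrank k (ℬ (i + t))) :
    Function.Injective (gradedMul hℓ t i) := by
  rcases hSLP t i with hi | hs
  · exact (injective_gradedMul_iff hℓ t i).mpr hi
  · have hs' := (surjective_gradedMul_iff hℓ t i).mpr hs
    exact (LinearMap.injective_iff_surjective_of_finrank_eq_finrank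
      (h.antisymm (LinearMap.finrank_le_finrank_of_surjective hs'))).mpr hs'

theorem surjective_gradedMul_of_le [GradedAlgebra ℬ] [FiniteDimensional k B] {ℓ : B}
    (hℓ : ℓ ∈ ℬ 1)
    (hSLP : ∀ t i : ℕ, Set.InjOn (fun a : B => ℓ ^ t * a) (ℬ i) ∨
      Set.SurjOn (fun a : B => ℓ ^ t * a) (ℬ i) (ℬ (i + t)))
    {t i : ℕ}
    (h : Module.finrank k (ℬ (i + t)) ≤ Module.finrank k (ℬ i)) :
    Function.Surjective (gradedMul hℓ t i) := by
  rcases hSLP t i with hi | hs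
  · have hi' := (injective_gradedMul_iff hℓ t i).mpr hi
    exact (LinearMap.injective_iff_surjective_of_finrank_eq_finrank
      ((LinearMap.finrank_le_finrank_of_injective hi').antisymm h)).mp hi'
  · exact (surjective_gradedMul_iff hℓ t i).mpr hs

/-- The power of `ℓ` from degree `i` to degree `l` factors through degree `j`, so a valley at `j`
would keep it from having full rank. -/
theorem hilb_unimodal [GradedAlgebra ℬ] [FiniteDimensional k B] {ℓ : B}
    (hℓ : ℓ ∈ ℬ 1)
    (hSLP : ∀ t i : ℕ, Set.InjOn (fun a : B => ℓ ^ t * a) (ℬ i) ∨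
      Set.SurjOn (fun a : B => ℓ ^ t * a) (ℬ i) (ℬ (i + t)))
    {i j l : ℤ} (hij : i < j) (hjl : j < l) (h1 : hilb ℬ j < hilb ℬ i)
    (h2 : hilb ℬ j < hilb ℬ l) : False := by
  have hi : 0 ≤ i := by
    by_contra! h
    rw [hilb_of_neg h] at h1
    omega
  obtain ⟨i, rfl⟩ := Int.eq_ofNat_of_zero_le hi
  obtain ⟨t, rfl⟩ : ∃ t : ℕ, j = ((i + t : ℕ) : ℤ) := ⟨(j - i).toNat, by omega⟩
  obtain ⟨u, rfl⟩ : ∃ u : ℕ, l = ((i + t + u : ℕ) : ℤ) := ⟨(l - (i + t : ℕ)).toNat, by omega⟩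
  rw [hilb_natCast, hilb_natCast] at h1 h2
  have hcomp : ∀ b : ℬ i, (gradedMul hℓ u (i + t) (gradedMul hℓ t i b) : B) =
      ℓ ^ (t + u) * b := by
    intro b
    rw [gradedMul_apply, gradedMul_apply, ← mul_assoc, ← pow_add, add_comm]
  rcases hSLP (t + u) i with hinj | hsurj
  · refine h1.not_ge (LinearMap.finrank_le_finrank_of_injective (f := gradedMul hℓ t i) ?_)
    intro b b' hbb
    refine (injective_gradedMul_iff hℓ (t + u) i).mpr hinj (Subtype.ext ?_)
    rw [gradedMul_apply, gradedMul_apply, ← hcomp, ← hcomp, hbb]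
  · refine h2.not_ge (LinearMap.finrank_le_finrank_of_surjective
      (f := gradedMul hℓ u (i + t)) ?_)
    rintro ⟨y, hy⟩
    obtain ⟨b, hb, hby⟩ := hsurj (by rwa [← add_assoc])
    exact ⟨gradedMul hℓ t i ⟨b, hb⟩, Subtype.ext ((hcomp ⟨b, hb⟩).trans hby)⟩

end HilbertFunction

/-- A unimodal almost centered function is nearly symmetric: there is `C` such that it increases
along pairs of sum at most `C` and decreases along pairs of larger sum. -/
theorem exists_center {h : ℤ → ℕ} (hneg : ∀ i, i < 0 → h i = 0) (hbd : ∃ N, ∀ i, N ≤ i → h i = 0)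
    (h0 : h 0 ≠ 0)
    (huni : ∀ i j l, i < j → j < l → h j < h i → h j < h l → False)
    (hup : ∀ i j : ℤ, i < j → h i < h j → ∀ s : ℕ, h (i - s) ≤ h (j + s))
    (hdown : ∀ i j : ℤ, i < j → h j < h i → ∀ s : ℕ, h (j + s) ≤ h (i - s)) :
    ∃ C : ℕ, (∀ i j : ℤ, i < j → i + j ≤ C → h i ≤ h j) ∧
      (∀ i j : ℤ, i < j → C + 1 ≤ i + j → h j ≤ h i) := by
  classical
  -- `C + 1` will be the least sum at which a strict descent occurs. The pair `(0, max N 1)` shows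
  -- that one exists, as `h 0 ≠ 0`.
  have hex : ∃ C : ℕ, ¬ ∀ i j : ℤ, i < j → i + j ≤ C → h i ≤ h j := by
    obtain ⟨N, hN⟩ := hbd
    refine ⟨(max N 1).toNat, fun H => ?_⟩
    have := H 0 (max N 1) (by omega) (by omega)
    rw [hN _ (le_max_left _ _)] at this
    omega
  obtain ⟨C, hC⟩ : ∃ C, Nat.find hex = C + 1 := by
    refine Nat.exists_eq_succ_of_ne_zero fun hz => ?_
    have := Nat.find_spec hex
    rw [hz] at this
    refine this fun i j hij hs => ?_
    rw [hneg i (by push_cast at hs; omega)]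
    exact Nat.zero_le _
  have hmin : ∀ i j : ℤ, i < j → i + j ≤ C → h i ≤ h j := by
    have := Nat.find_min hex (m := C) (by omega)
    push Not at this
    exact this
  have hspec := Nat.find_spec hex
  rw [hC] at hspec
  push Not at hspec
  obtain ⟨i₀, j₀, hij₀, hs₀, hlt₀⟩ := hspec
  have hs₀' : i₀ + j₀ = C + 1 := by
    by_contra hne
    have := hmin i₀ j₀ hij₀ (by push_cast at hs₀; omega)
    omega
  refine ⟨C, hmin, fun i j hij hs => ?_⟩
  by_contra! hlt
  -- Pairs of sum `C + 1` are nested around one another. Outside `(i₀, j₀)` the descent propagates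
  -- by `hdown`; inside, a strict rise would propagate outward by `hup` and contradict `hlt₀`.
  have hrefl : ∀ x y : ℤ, x < y → x + y = C + 1 → h y ≤ h x := by
    intro x y hxy hsum
    rcases le_total x i₀ with hx | hx
    · obtain ⟨u, hu⟩ := Int.eq_ofNat_of_zero_le (sub_nonneg.mpr hx)
      have := hdown i₀ j₀ hij₀ hlt₀ u
      rwa [show i₀ - (u : ℤ) = x by omega, show j₀ + (u : ℤ) = y by omega] at this
    · by_contra! hlt'
      obtain ⟨u, hu⟩ := Int.eq_ofNat_of_zero_le (sub_nonneg.mpr hx)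
      have := hup x y hxy hlt' u
      rw [show x - (u : ℤ) = i₀ by omega, show y + (u : ℤ) = j₀ by omega] at this
      omega
  -- A rise from `i` to `j` of larger sum, together with the reflection `C + 1 - j < i` of `j`,
  -- would make `i` a valley.
  have h1 := hrefl (C + 1 - j) j (by omega) (by omega)
  rcases eq_or_lt_of_le hs with heq | hlt'
  · rw [show (C : ℤ) + 1 - j = i by omega] at h1
    omega
  · exact huni (C + 1 - j) i j (by omega) hij (by omega) hlt

/-! ### From almost centered and SLP to the two-center condition -/

section Center

variable {k B : Type*} [Field k] [CommRing B] [Algebra k B] {ℬ : ℕ → Submodule k B}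

theorem IsAlmostCentered.exists_isNearlyLefschetz [GradedAlgebra ℬ] [FiniteDimensional k B]
    (hac : IsAlmostCentered ℬ) {ℓ : B} (hℓ : ℓ ∈ ℬ 1)
    (hSLP : ∀ t i : ℕ, Set.InjOn (fun a : B => ℓ ^ t * a) (ℬ i) ∨
      Set.SurjOn (fun a : B => ℓ ^ t * a) (ℬ i) (ℬ (i + t))) :
    ∃ C, IsNearlyLefschetz ℬ (LinearMap.mulLeft k ℓ) C := by
  have hmem : ∀ i, ∀ x ∈ ℬ i, LinearMap.mulLeft k ℓ x ∈ ℬ (i + 1) := fun i x hx => by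
    simpa using pow_mul_mem hℓ 1 hx
  rcases subsingleton_or_nontrivial B with hsub | hnt
  · exact ⟨0, hmem, fun _ _ _ _ _ _ => Subsingleton.elim _ _,
      fun _ _ _ _ _ => ⟨0, zero_mem _, Subsingleton.elim _ _⟩, fun _ _ => Subsingleton.elim _ _⟩
  obtain ⟨N, hN⟩ := exists_forall_eq_bot (ℬ := ℬ)
  have h0 : hilb ℬ 0 ≠ 0 := by
    have h := hilb_natCast (ℬ := ℬ) 0
    rw [Nat.cast_zero] at h
    rw [h]
    have : Nontrivial (ℬ 0) :=
      ⟨⟨⟨1, SetLike.GradedOne.one_mem⟩, 0, fun h => one_ne_zero (congrArg Subtype.val h)⟩⟩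
    exact Module.finrank_pos.ne'
  obtain ⟨C, hC1, hC2⟩ := exists_center (h := hilb ℬ) (fun i hi => hilb_of_neg hi)
    ⟨N, fun i hi => by
      obtain ⟨i, rfl⟩ := Int.eq_ofNat_of_zero_le ((Int.natCast_nonneg N).trans hi)
      rw [hilb_natCast, hN i (by omega), finrank_bot]⟩ h0
    (fun i j l => hilb_unimodal hℓ hSLP) hac.1 hac.2
  refine ⟨C, hmem, ?_, ?_, ?_⟩
  · intro i t hit x hx h
    rw [LinearMap.pow_mulLeft, LinearMap.mulLeft_apply] at h
    obtain rfl | ht := Nat.eq_zero_or_pos t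
    · simpa using h
    have hle := hC1 i (i + t : ℕ) (by omega) (by omega)
    rw [hilb_natCast, hilb_natCast] at hle
    have := injective_gradedMul_of_le hℓ hSLP hle (a₁ := ⟨x, hx⟩) (a₂ := 0)
      (Subtype.ext (by rw [gradedMul_apply, h, map_zero]; rfl))
    exact congrArg Subtype.val this
  · intro i t hit y hy
    obtain rfl | ht := Nat.eq_zero_or_pos t
    · exact ⟨y, hy, by simp⟩
    have hle := hC2 i (i + t : ℕ) (by omega) (by omega)
    rw [hilb_natCast, hilb_natCast] at hle
    obtain ⟨x, hx⟩ := surjective_gradedMul_of_le hℓ hSLP hle ⟨y, hy⟩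
    refine ⟨x, x.2, ?_⟩
    rw [LinearMap.pow_mulLeft, LinearMap.mulLeft_apply, ← gradedMul_apply hℓ, hx]
  · intro i hi
    -- Degree `-1`, where the Hilbert function is `0`, forces the high degrees to vanish.
    have hle := hC2 (-1) i (by omega) (by omega)
    rw [hilb_natCast, hilb_of_neg (by omega), Nat.le_zero, Submodule.finrank_eq_zero] at hle
    exact hle

end Center

/-! ### Violations of the almost centered condition obstruct the SLP -/

section Necessity

variable {k B : Type*} [Field k] [CommRing B] [Algebra k B] {ℬ : ℕ → Submodule k B}
  [GradedAlgebra ℬ]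

theorem exists_string [FiniteDimensional k B] {ℓ : B} (hℓ : ℓ ∈ ℬ 1) {a n : ℕ}
    (h : Module.finrank k (ℬ (a + n)) < Module.finrank k (ℬ a)) :
    ∃ v ∈ ℬ a, ∃ p, 1 ≤ p ∧ p ≤ n ∧ ℓ ^ p * v = 0 ∧ ℓ ^ (p - 1) * v ≠ 0 := by
  classical
  obtain ⟨v, hv, hv0⟩ := Submodule.exists_mem_ne_zero_of_ne_bot
    (LinearMap.ker_ne_bot_of_finrank_lt (f := gradedMul hℓ n a) h)
  have hv' : ℓ ^ n * (v : B) = 0 := congrArg Subtype.val (LinearMap.mem_ker.mp hv)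
  have hex : ∃ p, ℓ ^ p * (v : B) = 0 := ⟨n, hv'⟩
  have hpos : 1 ≤ Nat.find hex := by
    rw [Nat.one_le_iff_ne_zero]
    intro h0
    have := Nat.find_spec hex
    rw [h0, pow_zero, one_mul] at this
    exact hv0 (Subtype.ext this)
  exact ⟨v, v.2, Nat.find hex, hpos, Nat.find_min' hex hv', Nat.find_spec hex,
    Nat.find_min hex (by omega)⟩

/-- By dimension `ℓ ^ n` cannot hit all of `B_b`, so some functional supported in degree `b`
vanishes on its image. The integer `b - n` includes the case `b < n`, where the image is zero in
degree `b`. -/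
theorem exists_dual_string [FiniteDimensional k B] {ℓ : B} (hℓ : ℓ ∈ ℬ 1) {b n : ℕ}
    (h : hilb ℬ ((b : ℤ) - n) < hilb ℬ b) :
    ∃ φ : B →ₗ[k] k, (∀ i, i ≠ b → ∀ y ∈ ℬ i, φ y = 0) ∧
      ∃ p, 1 ≤ p ∧ p ≤ n ∧ (∀ y, φ (ℓ ^ p * y) = 0) ∧ ∃ y, φ (ℓ ^ (p - 1) * y) ≠ 0 := by
  classical
  have hℓn : ℓ ^ n ∈ ℬ n := by
    have := SetLike.pow_mem_graded n hℓ
    rwa [smul_eq_mul, mul_one] at this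
  obtain ⟨w, hw, hwR⟩ : ∃ w ∈ ℬ b, w ∉ LinearMap.range (LinearMap.mulLeft k (ℓ ^ n)) := by
    by_contra! H
    rcases Nat.lt_or_ge b n with hbn | hbn
    · have : ℬ b = ⊥ := by
        refine eq_bot_iff.mpr fun w hw => ?_
        obtain ⟨y, rfl⟩ := H w hw
        rw [LinearMap.mulLeft_apply] at hw ⊢
        rw [Submodule.mem_bot, ← DirectSum.decompose_of_mem_same ℬ hw,
          DirectSum.coe_decompose_mul_of_left_mem_of_not_le ℬ hℓn (by omega)]
      rw [hilb_natCast, this, finrank_bot] at h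
      omega
    · obtain ⟨a, rfl⟩ := Nat.exists_eq_add_of_le' hbn
      rw [show ((a + n : ℕ) : ℤ) - n = a by push_cast; ring, hilb_natCast, hilb_natCast] at h
      refine h.not_ge (LinearMap.finrank_le_finrank_of_surjective (f := gradedMul hℓ n a) ?_)
      rintro ⟨w, hw⟩
      obtain ⟨y, rfl⟩ := H w hw
      refine ⟨DirectSum.decompose ℬ y a, Subtype.ext ?_⟩
      change ℓ ^ n * _ = ℓ ^ n * y
      rw [LinearMap.mulLeft_apply] at hw
      rw [← DirectSum.decompose_of_mem_same ℬ hw,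
        DirectSum.coe_decompose_mul_of_left_mem_of_le ℬ hℓn (by omega), Nat.add_sub_cancel]
      rfl
  obtain ⟨f, hfw, hfR⟩ := Submodule.exists_dual_map_eq_bot_of_notMem hwR inferInstance
  have hfR' : ∀ y, f (ℓ ^ n * y) = 0 := fun y =>
    (Submodule.mem_bot k).mp (hfR ▸ Submodule.mem_map_of_mem ⟨y, rfl⟩)
  set φ : B →ₗ[k] k := f ∘ₗ (ℬ b).subtype ∘ₗ DirectSum.component k ℕ (fun i => ℬ i) b ∘ₗ
    (DirectSum.decomposeLinearEquiv ℬ).toLinearMap with hφ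
  have hφx : ∀ y, φ y = f (DirectSum.decompose ℬ y b) := fun y => rfl
  have hφn : ∀ y, φ (ℓ ^ n * y) = 0 := by
    intro y
    rw [hφx]
    by_cases hbn : n ≤ b
    · rw [DirectSum.coe_decompose_mul_of_left_mem_of_le ℬ hℓn hbn, hfR']
    · rw [DirectSum.coe_decompose_mul_of_left_mem_of_not_le ℬ hℓn hbn, map_zero]
  have hφw : φ w ≠ 0 := by rwa [hφx, DirectSum.decompose_of_mem_same ℬ hw]
  have hex : ∃ p, ∀ y, φ (ℓ ^ p * y) = 0 := ⟨n, hφn⟩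
  have hpos : 1 ≤ Nat.find hex := by
    rw [Nat.one_le_iff_ne_zero]
    intro h0
    have := Nat.find_spec hex w
    rw [h0, pow_zero, one_mul] at this
    exact hφw this
  refine ⟨φ, fun i hi y hy => ?_, Nat.find hex, hpos, Nat.find_min' hex hφn, Nat.find_spec hex, ?_⟩
  · rw [hφx, DirectSum.decompose_of_mem_ne ℬ hy hi, map_zero]
  · have := Nat.find_min hex (m := Nat.find hex - 1) (by omega)
    push Not at this
    exact this

variable {T : Type*} [CommRing T] [Algebra k T] {𝒯 : ℕ → Submodule k T}

/-- A string and a dual string of incompatible sizes contradict the strong Lefschetz property of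
`B ⊗ T`. -/
theorem IsCoeff.not_injOn_or_surjOn {x : T} {d : ℕ} {γ : ℕ → T →ₗ[k] k} (hγ : IsCoeff x d γ)
    (hx : ∀ j, x ^ j ∈ 𝒯 j) {ℓ : B} (hℓ : ℓ ∈ ℬ 1) (c : k) {a p r g t b p' r' g' m : ℕ} {v : B}
    (hv : v ∈ ℬ a) (hp : ℓ ^ p * v = 0) (hp' : ℓ ^ (p - 1) * v ≠ 0) (hr : 1 ≤ r) (hrp : r ≤ p)
    (hrg : r ≤ g + 1) (hgd : g + 1 ≤ d) (hcount : p + d < r + g + t + 1)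
    {φ : B →ₗ[k] k} (hφ : ∀ i, i ≠ b → ∀ y ∈ ℬ i, φ y = 0) (hφp : ∀ y, φ (ℓ ^ p' * y) = 0)
    (hφp' : ∃ y, φ (ℓ ^ (p' - 1) * y) ≠ 0) (hr' : 1 ≤ r') (hrp' : r' ≤ p') (hgd' : g' + r' ≤ d)
    (hcount' : p' + g' < r' + t) (hm : a + g = m) (hmt : b + g' = m + t) :
    ¬ (Set.InjOn (fun z => mixedForm ℓ c x ^ t * z) (tensorGrading ℬ 𝒯 m) ∨
      Set.SurjOn (fun z => mixedForm ℓ c x ^ t * z) (tensorGrading ℬ 𝒯 m)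
        (tensorGrading ℬ 𝒯 (m + t))) := by
  have hℓmul : ∀ i, ∀ b ∈ ℬ i, ℓ * b ∈ ℬ (i + 1) := fun i b hb => by
    simpa using pow_mul_mem hℓ 1 hb
  subst hm
  rw [← hmt]
  rintro (hinj | hsurj)
  · obtain ⟨z, hz, hz0, hz'⟩ := hγ.exists_pow_mul_eq_zero hx hℓmul c hv hp hp' hr hrp hrg hgd hcount
    exact hz0 (hinj hz (zero_mem _) (by simpa using hz'))
  · obtain ⟨y, hy, hy'⟩ := hγ.exists_forall_pow_mul_ne hx hℓmul c hφ hφp hφp' hr' hrp' hgd' hcount'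
    obtain ⟨z, -, hz⟩ := hsurj hy
    exact hy' z hz

theorem isAlmostCentered_of_hasSLP [FiniteDimensional k B] (h0 : ℬ 0 = 1)
    (H : ∀ d, 1 ≤ d → ∃ (T : Type _) (_ : CommRing T) (_ : Algebra k T) (𝒯 : ℕ → Submodule k T)
      (x : T) (γ : ℕ → T →ₗ[k] k), IsCoeff x d γ ∧ (∀ j, x ^ j ∈ 𝒯 j) ∧
        𝒯 0 ≤ Submodule.span k {1} ∧ 𝒯 1 ≤ Submodule.span k {x} ∧ HasSLP (tensorGrading ℬ 𝒯)) :
    IsAlmostCentered ℬ := by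
  refine ⟨fun i j hij hlt s => ?_, fun i j hij hlt s => ?_⟩
  · by_contra! hlt'
    have hi : 0 ≤ i - s := by
      by_contra! h
      rw [hilb_of_neg h] at hlt'
      omega
    obtain ⟨a, ha⟩ := Int.eq_ofNat_of_zero_le hi
    obtain ⟨δ, hδ⟩ := Int.eq_ofNat_of_zero_le (sub_nonneg.mpr hij.le)
    obtain rfl : i = a + s := by omega
    obtain rfl : j = (a + s + δ : ℕ) := by push_cast; omega
    have hδ0 : 1 ≤ δ := by omega
    obtain ⟨T, _, _, 𝒯, x, γ, hγ, hx, h𝒯0, h𝒯1, e, he, hSLP⟩ := H (δ + s) (by omega)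
    obtain ⟨ℓ, hℓ, c, rfl⟩ := exists_eq_mixedForm h0 h𝒯0 h𝒯1 he
    rw [ha, hilb_natCast, ← Nat.cast_add, hilb_natCast, show a + s + δ + s = a + (δ + 2 * s) by ring]
      at hlt'
    obtain ⟨v, hv, p, hp1, hpn, hp, hp'⟩ := exists_string hℓ hlt'
    obtain ⟨φ, hφ, p', hp1', hpn', hφp, hφp'⟩ := exists_dual_string (ℬ := ℬ) hℓ
      (b := a + s + δ) (n := δ) (by
        rwa [show ((a + s + δ : ℕ) : ℤ) - δ = a + s by push_cast; ring])
    -- With `d = δ + s`, the string starts in degree `i - s` and has `p ≤ δ + 2s`; it is paired with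
    -- `x`-degrees up to `d - 1`. The functional lives in degree `j` with `p' ≤ δ`, so the exponents
    -- `s, …, s + p' - 1` stay below `d`.
    exact hγ.not_injOn_or_surjOn hx hℓ c (t := s + 1) (g := δ + s - 1) (r := min p (δ + s))
      (g' := s) (r' := p') (m := a + s + δ - 1) hv hp hp' (by omega) (by omega) (by omega) (by omega)
      (by omega) hφ hφp hφp' hp1' le_rfl (by omega) (by omega) (by omega) (by omega) (hSLP _ _)
  · by_contra! hlt'
    have hi : 0 ≤ i := by
      by_contra! h
      rw [hilb_of_neg h] at hlt
      omega
    obtain ⟨a, rfl⟩ := Int.eq_ofNat_of_zero_le hi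
    obtain ⟨δ, hδ⟩ := Int.eq_ofNat_of_zero_le (sub_nonneg.mpr hij.le)
    obtain rfl : j = (a + δ : ℕ) := by push_cast; omega
    have hδ0 : 1 ≤ δ := by omega
    obtain ⟨T, _, _, 𝒯, x, γ, hγ, hx, h𝒯0, h𝒯1, e, he, hSLP⟩ := H (δ + s) (by omega)
    obtain ⟨ℓ, hℓ, c, rfl⟩ := exists_eq_mixedForm h0 h𝒯0 h𝒯1 he
    rw [hilb_natCast, hilb_natCast] at hlt
    obtain ⟨v, hv, p, hp1, hpn, hp, hp'⟩ := exists_string hℓ hlt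
    obtain ⟨φ, hφ, p', hp1', hpn', hφp, hφp'⟩ := exists_dual_string (ℬ := ℬ) hℓ
      (b := a + δ + s) (n := δ + 2 * s) (by
        rwa [show ((a + δ + s : ℕ) : ℤ) - (δ + 2 * s : ℕ) = a - s by push_cast; ring,
          Nat.cast_add (a + δ)])
    -- Same map from degree `j - 1` to `j + s`, with the roles exchanged: the string in degree `i`
    -- has `p ≤ δ`, and the functional in degree `j + s` has `p' ≤ δ + 2s`, so now `p'` is cut down
    -- to `d`.
    exact hγ.not_injOn_or_surjOn hx hℓ c (t := s + 1) (g := δ - 1) (r := p)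
      (g' := 0) (r' := min p' (δ + s)) (m := a + δ - 1) hv hp hp' (by omega) (by omega) (by omega) (by omega)
      (by omega) hφ hφp hφp' (by omega) (by omega) (by omega) (by omega) (by omega) (by omega)
      (hSLP _ _)

end Necessity

/-! ### Monomial complete intersections with one essential variable -/

section SingleVariable

open MvPolynomial

variable (k : Type*) [Field k] {n : ℕ} {d : Fin n → ℕ}

theorem one_mem_monomialCIGrading : (1 : MonomialCI k d) ∈ monomialCIGrading k d 0 :=
  (mem_monomialCIGrading k).mpr ⟨1, isHomogeneous_one _ _, map_one _⟩

theorem ciX_pow_mem (i : Fin n) (j : ℕ) : ciX k d i ^ j ∈ monomialCIGrading k d j :=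
  (mem_monomialCIGrading k).mpr ⟨X i ^ j, isHomogeneous_X_pow i j, map_pow _ _ _⟩

theorem monomialCIGrading_zero_le : monomialCIGrading k d 0 ≤ Submodule.span k {1} := by
  intro y hy
  obtain ⟨f, hf, rfl⟩ := (mem_monomialCIGrading k).mp hy
  rw [← totalDegree_zero_iff_isHomogeneous, totalDegree_eq_zero_iff_eq_C] at hf
  rw [hf, Submodule.mem_span_singleton]
  refine ⟨coeff 0 f, ?_⟩
  rw [← mul_one (C (coeff 0 f)), ← smul_eq_C_mul, map_smul, map_one]

theorem monomialCIGrading_one_le {i₀ : Fin n} (hd : ∀ i, i ≠ i₀ → d i = 1) :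
    monomialCIGrading k d 1 ≤ Submodule.span k {ciX k d i₀} := by
  intro y hy
  obtain ⟨f, hf, rfl⟩ := (mem_monomialCIGrading k).mp hy
  have hf' : f ∈ homogeneousSubmodule (Fin n) k 1 := hf
  rw [homogeneousSubmodule_one_eq_span_X] at hf'
  have hle : Submodule.span k (Set.range X) ≤ (Submodule.span k {ciX k d i₀}).comap
      (Ideal.Quotient.mkₐ k (powIdeal k d)).toLinearMap := by
    rw [Submodule.span_le]
    rintro _ ⟨i, rfl⟩
    by_cases hi : i = i₀
    · subst hi
      exact Submodule.mem_span_singleton_self _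
    · have h0 : ciX k d i = 0 := by
        have := ciX_pow k (d := d) i
        rwa [hd i hi, pow_one] at this
      change ciX k d i ∈ Submodule.span k {ciX k d i₀}
      rw [h0]
      exact zero_mem _
  exact hle hf'

/-- The coefficient of `x_{i₀}^w` is read on a representative. For `w < d i₀` this is well defined,
since no element of the ideal involves that monomial: the other generators are the remaining
variables. -/
theorem exists_isCoeff {i₀ : Fin n} (hd₀ : 1 ≤ d i₀) (hd : ∀ i, i ≠ i₀ → d i = 1) :
    ∃ γ : ℕ → MonomialCI k d →ₗ[k] k, IsCoeff (ciX k d i₀) (d i₀) γ := by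
  set Q := Ideal.Quotient.mkₐ k (powIdeal k d) with hQ
  have hsurj : Function.Surjective Q := Ideal.Quotient.mkₐ_surjective k _
  obtain ⟨σ, hσ⟩ := Q.toLinearMap.exists_rightInverse_of_surjective
    (LinearMap.range_eq_top.mpr hsurj)
  have hideal : ∀ f ∈ powIdeal k d, ∀ w < d i₀, coeff (Finsupp.single i₀ w) f = 0 := by
    intro f hf w hw
    obtain ⟨c, rfl⟩ := Ideal.mem_span_range_iff_exists_fun.mp hf
    rw [coeff_sum]
    refine Finset.sum_eq_zero fun i _ => ?_
    rw [X_pow_eq_monomial, coeff_mul_monomial', if_neg]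
    rw [Finsupp.single_le_iff]
    by_cases hi : i = i₀
    · subst hi
      simpa using hw
    · rw [Finsupp.single_eq_of_ne hi, hd i hi]
      omega
  have hγQ : ∀ f, ∀ w < d i₀, coeff (Finsupp.single i₀ w) (σ (Q f)) =
      coeff (Finsupp.single i₀ w) f := by
    intro f w hw
    rw [← sub_eq_zero, ← coeff_sub]
    refine hideal _ ?_ w hw
    rw [← Ideal.Quotient.eq_zero_iff_mem, map_sub, sub_eq_zero]
    exact LinearMap.congr_fun hσ (Q f)
  have hX : ciX k d i₀ = Q (X i₀) := rfl
  refine ⟨fun w => lcoeff k (Finsupp.single i₀ w) ∘ₗ σ, ?_, ?_, ?_, ?_, ciX_pow k i₀⟩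
  · intro y
    obtain ⟨f, rfl⟩ := hsurj y
    change coeff _ (σ (ciX k d i₀ * Q f)) = 0
    rw [hX, ← map_mul, hγQ _ _ hd₀]
    simp [coeff_X_mul']
  · intro w hw y
    obtain ⟨f, rfl⟩ := hsurj y
    change coeff _ (σ (ciX k d i₀ * Q f)) = coeff _ (σ (Q f))
    rw [hX, ← map_mul, hγQ _ _ hw, hγQ _ _ (by omega), add_comm, Finsupp.single_add, coeff_X_mul]
  · change coeff _ (σ 1) = 1
    rw [← map_one Q, hγQ _ _ hd₀]
    simp
  · intro w hw
    change coeff _ (σ 1) = 0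
    rw [← map_one Q, hγQ _ _ hw, coeff_one, if_neg]
    intro h
    have := DFunLike.congr_fun h i₀
    simp at this

end SingleVariable

end Lefschetz

theorem proposition5p8 {k : Type*} [Field k] [CharZero k] {B : Type*} [CommRing B] [Algebra k B]
    (ℬ : ℕ → Submodule k B) [GradedAlgebra ℬ] (hB : Lefschetz.IsStandardGraded ℬ)
    (hart : IsArtinianRing B) (n : ℕ) (hn : 1 ≤ n) :
    (∀ d : Fin n → ℕ, (∀ i, 1 ≤ d i) →
      ∃ e : (B ⊗[k] (⨂[k] i, Lefschetz.Trunc k (d i))) ≃ₐ[k] (B ⊗[k] Lefschetz.MonomialCI k d),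
        ∀ m : ℕ,
          (Lefschetz.tensorGrading ℬ
            (Lefschetz.piTensorGrading fun i => Lefschetz.truncGrading k (d i)) m).map
              e.toLinearMap =
            Lefschetz.tensorGrading ℬ (Lefschetz.monomialCIGrading k d) m) ∧
    ((∀ d : Fin n → ℕ, (∀ i, 1 ≤ d i) →
        Lefschetz.HasSLP (Lefschetz.tensorGrading ℬ (Lefschetz.monomialCIGrading k d))) ↔
      Lefschetz.IsAlmostCentered ℬ ∧ Lefschetz.HasSLP ℬ) := by
  have := hB.finiteDimensional hart
  refine ⟨fun d _ => ⟨_, Lefschetz.map_tensorGrading ℬ (Lefschetz.piTruncEquiv k d)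
    (Lefschetz.map_piTensorGrading k d)⟩, fun H => ?_, ?_⟩
  -- The exponents `(m, 1, …, 1)` kill all variables but one; general `m` gives the almost centered
  -- condition and `m = 1` the SLP of `B`.
  · set i₀ : Fin n := ⟨0, hn⟩
    have hd : ∀ m, 1 ≤ m → ∀ i, 1 ≤ Function.update (fun _ => 1) i₀ m i := by
      intro m hm i
      by_cases hi : i = i₀
      · subst hi; simpa using hm
      · simp [hi]
    have hd₀ : ∀ m, Function.update (fun _ : Fin n => 1) i₀ m i₀ = m := fun m => by simp
    have hd₁ : ∀ m i, i ≠ i₀ → Function.update (fun _ : Fin n => 1) i₀ m i = 1 := fun m i hi => by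
      simp [hi]
    constructor
    · refine Lefschetz.isAlmostCentered_of_hasSLP hB.degree_zero fun m hm => ?_
      obtain ⟨γ, hγ⟩ := Lefschetz.exists_isCoeff k ((hd₀ m).symm ▸ hm) (hd₁ m)
      rw [hd₀] at hγ
      exact ⟨_, _, _, _, _, γ, hγ, Lefschetz.ciX_pow_mem k i₀,
        Lefschetz.monomialCIGrading_zero_le k, Lefschetz.monomialCIGrading_one_le k (hd₁ m),
        H _ (hd m hm)⟩
    · obtain ⟨γ, hγ⟩ := Lefschetz.exists_isCoeff k (hd₀ 1).ge (hd₁ 1)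
      rw [hd₀] at hγ
      refine Lefschetz.hasSLP_of_hasSLP_tensorGrading hB.degree_zero hγ
        (Lefschetz.one_mem_monomialCIGrading k) (Lefschetz.monomialCIGrading_zero_le k)
        (Lefschetz.monomialCIGrading_one_le k (hd₁ 1)) (fun j hj => ?_) (H _ (hd 1 le_rfl))
      refine Lefschetz.monomialCIGrading_eq_bot k ?_
      rw [Finset.sum_eq_zero fun i _ => ?_]
      · omega
      · by_cases hi : i = i₀
        · rw [hi, hd₀, Nat.sub_self]
        · rw [hd₁ 1 i hi, Nat.sub_self]
  · rintro ⟨hac, ℓ, hℓ, hSLP⟩ d hd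
    obtain ⟨C, hC⟩ := hac.exists_isNearlyLefschetz hℓ hSLP
    obtain ⟨G, hG0, hG, hcomm⟩ := Lefschetz.exists_ciLower k hd
    refine hC.hasSLP_tensorGrading hℓ SetLike.GradedOne.one_mem
      (x := ∑ i, Lefschetz.ciX k d i) (Submodule.sum_mem _ fun i _ => Lefschetz.ciX_mem k i)
      (Lefschetz.one_mem_monomialCIGrading k) (fun j y hy => ?_)
      ⟨_, fun j hj => Lefschetz.monomialCIGrading_eq_bot k (Nat.lt_of_succ_le hj)⟩ hG0 hG hcomm
    rw [add_comm]
    exact Lefschetz.monomialCIGrading_mul_mem k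
      (Submodule.sum_mem _ fun i _ => Lefschetz.ciX_mem k i) hy
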